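/- Let $D$ be a planar diagram of an oriented knot $L$, with a base point on one of its edges. Let $n_+$, $n_-$ be its numbers of positive and negative crossings. For a commutative ring $R$ and $t\in R$ consider the Frobenius system $A=R[X]/(X^2-t)$ with $$\Delta(1)=1\otimes X+X\otimes 1,\qquad \Delta(X)=X\otimes X+t\,1\otimes 1 .$$ It defines a complex $C(D;R,t)$: the total complex of Khovanov's cube of resolutions of $D$, with $A^{\otimes k}$ (over $R$) at a vertex $v$ whose resolution consists of $k$ circles, and with the multiplication or $\Delta$ (with the usual signs) along the edges. A vertex with $|v|$ one-smoothings lies in cohomological degree $|v|-n_-$; here the $0$-smoothing of a positive crossing and the $1$-smoothing of a negative crossing are the oriented ones. Multiplication by $X$ in the factor of the circle through the base point commutes with the differential. Let $\mathrm H_t(L)$ be the cohomology of $C_t(D)=C(D;\mathbb Q[t],t)$, let $\mathrm{Tor}(L)$ be its $\mathbb Q[t]$-torsion submodule and $\mathrm H'(L)=\mathrm H_t(L)/\mathrm{Tor}(L)$. The action of $X$ makes $\mathrm H'(L)$ a $\mathbb Q[X]$-module, with $X^2=t$. The $q$-grading is the one in which $t$ has degree $4$, the elements $1$ and $X$ of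 each factor $A$ have degrees $-1$ and $1$, and the vertex $v$ is shifted by $-|v|-n_++2n_-$; $\mathbb Q[X]\{k\}$ denotes $\mathbb Q[X]$ graded so that $X^m$ has degree $2m+k$. Rasmussen's invariant $s(L)$ is defined from Lee's complex $C(D;\mathbb Q,1)$. Give the elements $1$ and $X$ of each factor the degrees $1$ and $-1$, shift the vertex $v$ by $|v|+n_+-2n_-$, and filter the complex by the subspaces $F_k$ of chains all of whose homogeneous components have degree at least $k$. The filtration degree of a nonzero class in Lee's homology is the largest $k$ such that the class is represented by a cycle in $F_k$. Let $s_{\min}$ and $s_{\max}$ be the smallest and the largest filtration degree of a nonzero class; then $s_{\min}=s(L)-1$ and $s_{\max}=s(L)+1$. **Proposition.** For every such diagram and base point, $\mathrm H'(L)$ is a free $\mathbb Q[X]$-module of rank one, concentrated in cohomological degree $0$. Moreover there is an even integer $s'(L)$ such that $\mathrm H'(L)\cong\mathbb Q[X]\{-s'(L)-1\}$ as graded $\mathbb Q[X]$-modules, and $s'(L)$ equals Rasmussen's invariant: $s_{\min}=s'(L)-1$ and $s_{\max}=s'(L)+1$. -/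

import Mathlib

open scoped Polynomial

noncomputable section

/-- A signed Gauss code with `n` crossings, recording a generic closed oriented curve with a
chosen base point (not a crossing).  Travelling once along the curve from the base point one makes
`2 n` passages, at times `0, …, 2 n - 1`; the passage at crossing `c` along the lower strand
happens at time `visit (inl c)`, the one along the upper strand at time `visit (inr c)`, and
`positive c` tells whether the crossing is positive (right-handed) or negative. -/
structure GaussCode where
  n : ℕ
  visit : Fin n ⊕ Fin n ≃ Fin (2 * n)
  positive : Fin n → Bool

namespace GaussCode

variable (D : GaussCode)

/-- The edges of the curve cut at the base point and at all passages, in the order in which they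
are traversed.  The passage at time `k` leads from edge `k` to edge `k + 1`, and the last edge is
joined to edge `0` at the base point. -/
abbrev Edge : Type := Fin (2 * D.n + 1)

/-- Incoming edge of the lower strand at a crossing. -/
def underIn (c : Fin D.n) : D.Edge := (D.visit (Sum.inl c)).castSucc

/-- Outgoing edge of the lower strand at a crossing. -/
def underOut (c : Fin D.n) : D.Edge := (D.visit (Sum.inl c)).succ

/-- Incoming edge of the upper strand at a crossing. -/
def overIn (c : Fin D.n) : D.Edge := (D.visit (Sum.inr c)).castSucc

/-- Outgoing edge of the upper strand at a crossing. -/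
def overOut (c : Fin D.n) : D.Edge := (D.visit (Sum.inr c)).succ

/-! ### Planarity

A Gauss code determines a 4-valent graph with a cyclic order of the edges at each crossing, hence a
closed oriented surface obtained by gluing discs to it along the boundary walks.  The code is that
of a knot diagram on the sphere exactly if this (connected) surface has Euler characteristic 2. -/

/-- One of the two sides of an edge: `(e, false)` is the left side, `(e, true)` the right side,
with respect to the direction of travel. -/
abbrev Side : Type := D.Edge × Bool

/-- Two sides which meet in one of the four corners of a crossing, or at the base point.
Counterclockwise, starting from the incoming lower edge, the edges at a positive crossing are
`underIn, overOut, underOut, overIn`, and at a negative one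
`underIn, overIn, underOut, overOut`. -/
inductive Corner : D.Side → D.Side → Prop
  | base (b : Bool) : Corner (Fin.last _, b) (0, b)
  | pos₁ (c : Fin D.n) (h : D.positive c = true) :
      Corner (D.underIn c, true) (D.overOut c, true)
  | pos₂ (c : Fin D.n) (h : D.positive c = true) :
      Corner (D.overOut c, false) (D.underOut c, true)
  | pos₃ (c : Fin D.n) (h : D.positive c = true) :
      Corner (D.underOut c, false) (D.overIn c, false)
  | pos₄ (c : Fin D.n) (h : D.positive c = true) :
      Corner (D.overIn c, true) (D.underIn c, false)
  | neg₁ (c : Fin D.n) (h : D.positive c = false) :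
      Corner (D.underIn c, true) (D.overIn c, false)
  | neg₂ (c : Fin D.n) (h : D.positive c = false) :
      Corner (D.overIn c, true) (D.underOut c, true)
  | neg₃ (c : Fin D.n) (h : D.positive c = false) :
      Corner (D.underOut c, false) (D.overOut c, true)
  | neg₄ (c : Fin D.n) (h : D.positive c = false) :
      Corner (D.overOut c, false) (D.underIn c, false)

/-- The faces: boundary walks of the regions of the complement of the curve. -/
def Face : Type := Quot D.Corner

/-- The surface has genus zero.  Counting the base point as a vertex there are `n + 1` vertices and
`2 n + 1` edges, so that Euler characteristic 2 means `n + 2` faces. -/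
def IsPlanar : Prop := Nat.card D.Face = D.n + 2

/-! ### The cube of resolutions -/

/-- A vertex of the cube: a choice of the `0`-smoothing (`false`) or the `1`-smoothing (`true`)
at each crossing. -/
abbrev Vertex : Type := Fin D.n → Bool

/-- Number of `1`-smoothings. -/
def weight (v : D.Vertex) : ℕ := (Finset.univ.filter fun c => v c = true).card

/-- Number of positive crossings. -/
def nPos : ℕ := (Finset.univ.filter fun c => D.positive c = true).card

/-- Number of negative crossings. -/
def nNeg : ℕ := (Finset.univ.filter fun c => D.positive c = false).card

/-- The pairs of edges joined in the resolution `v`.  The `0`-smoothing of a positive crossing and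
the `1`-smoothing of a negative crossing respect the orientation (each incoming edge is joined to
the outgoing edge of the other strand); the other two smoothings join the two incoming edges, and
the two outgoing edges. -/
inductive Joined (v : D.Vertex) : D.Edge → D.Edge → Prop
  | base : Joined v (Fin.last _) 0
  | oriented₁ (c : Fin D.n) (h : D.positive c ≠ v c) : Joined v (D.underIn c) (D.overOut c)
  | oriented₂ (c : Fin D.n) (h : D.positive c ≠ v c) : Joined v (D.overIn c) (D.underOut c)
  | unoriented₁ (c : Fin D.n) (h : D.positive c = v c) : Joined v (D.underIn c) (D.overIn c)
  | unoriented₂ (c : Fin D.n) (h : D.positive c = v c) : Joined v (D.underOut c) (D.overOut c)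

/-- The circles of the resolution `v`. -/
def Circle (v : D.Vertex) : Type := Quot (D.Joined v)

/-- The circle through an edge. -/
def circle (v : D.Vertex) (e : D.Edge) : D.Circle v := Quot.mk _ e

instance (v : D.Vertex) : Finite (D.Circle v) := Finite.of_surjective _ Quot.mk_surjective

instance (v : D.Vertex) : Fintype (D.Circle v) := Fintype.ofFinite _

/-- The number of circles of a resolution. -/
def numCircles (v : D.Vertex) : ℕ := Fintype.card (D.Circle v)

open Classical in
/-- The edges on a circle. -/
def edgesOf {v : D.Vertex} (s : D.Circle v) : Finset D.Edge :=
  Finset.univ.filter fun e => D.circle v e = s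

lemma mem_edgesOf {v : D.Vertex} (s : D.Circle v) (e : D.Edge) :
    e ∈ D.edgesOf s ↔ D.circle v e = s := by
  simp [edgesOf]

lemma edgesOf_nonempty {v : D.Vertex} (s : D.Circle v) : (D.edgesOf s).Nonempty :=
  (Quot.mk_surjective s).imp fun e he => (D.mem_edgesOf s e).2 he

/-- The edge of a circle that is traversed first. -/
def firstEdge {v : D.Vertex} (s : D.Circle v) : D.Edge := (D.edgesOf s).min' (D.edgesOf_nonempty s)

lemma firstEdge_circle_zero (v : D.Vertex) : D.firstEdge (D.circle v 0) = 0 :=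
  le_antisymm (Finset.min'_le _ _ ((D.mem_edgesOf _ _).2 rfl)) (Fin.zero_le _)

/-! ### The complex

Let `A = R[X]/(X² - t)` with `Δ(1) = 1 ⊗ X + X ⊗ 1` and `Δ(X) = X ⊗ X + t 1 ⊗ 1`. -/

variable (R : Type) [CommRing R] (t : R)

/-- The ideal `(x_s² - t)`. -/
def relIdeal (S : Type) : Ideal (MvPolynomial S R) :=
  Ideal.span (Set.range fun s => MvPolynomial.X s ^ 2 - MvPolynomial.C t)

/-- The tensor power `A^{⊗ S}` over `R`, as the commutative algebra
`R[x_s : s ∈ S]/(x_s² - t)`, where `x_s` is the element `X` in the factor of index `s`. -/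
def TensorPower (S : Type) : Type := MvPolynomial S R ⧸ relIdeal R t S

instance (S : Type) : CommRing (TensorPower R t S) :=
  inferInstanceAs (CommRing (MvPolynomial S R ⧸ relIdeal R t S))

instance (k : Type) [CommRing k] [Algebra k R] (S : Type) : Algebra k (TensorPower R t S) :=
  inferInstanceAs (Algebra k (MvPolynomial S R ⧸ relIdeal R t S))

instance (k : Type) [CommRing k] [Algebra k R] (S : Type) :
    IsScalarTower k R (TensorPower R t S) :=
  inferInstanceAs (IsScalarTower k R (MvPolynomial S R ⧸ relIdeal R t S))

/-- The element `X` in the tensor factor of index `s`. -/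
def gen {S : Type} (s : S) : TensorPower R t S :=
  Ideal.Quotient.mk (relIdeal R t S) (MvPolynomial.X s)

lemma gen_sq {S : Type} (s : S) : gen R t s ^ 2 = algebraMap R _ t := by
  have h : MvPolynomial.X s ^ 2 - MvPolynomial.C t ∈ relIdeal R t S :=
    Ideal.subset_span ⟨s, rfl⟩
  exact (Ideal.Quotient.eq.2 h :)

/-- A map of index sets induces a homomorphism of tensor powers, which multiplies the factors in
each fibre. -/
def tensorMap {S T : Type} (f : S → T) : TensorPower R t S →ₐ[R] TensorPower R t T :=
  Ideal.Quotient.liftₐ (relIdeal R t S) (MvPolynomial.aeval fun s => gen R t (f s)) (by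
    intro a ha
    rw [← RingHom.mem_ker]
    refine (Ideal.span_le.2 ?_ : relIdeal R t S ≤ RingHom.ker _) ha
    rintro _ ⟨s, rfl⟩
    simp [RingHom.mem_ker, gen_sq])

lemma tensorMap_gen {S T : Type} (f : S → T) (s : S) :
    tensorMap R t f (gen R t s) = gen R t (f s) := by
  change MvPolynomial.aeval (fun s => gen R t (f s)) (MvPolynomial.X s) = _
  simp

/-- The `R`-module at a vertex of the cube. -/
abbrev VertexModule (v : D.Vertex) : Type := TensorPower R t (D.Circle v)

open Classical in
/-- The factor `1` for a merge, and `Δ(1)` in the factors of the two new circles for a split, when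
the smoothing at `c` is changed.  The two arcs of either smoothing at `c` contain `underIn c` and
`underOut c` respectively, so that the change is a merge exactly if these edges are on different
circles beforehand. -/
def edgeFactor (v w : D.Vertex) (c : Fin D.n) : D.VertexModule R t w :=
  if D.circle v (D.underIn c) = D.circle v (D.underOut c) then
    gen R t (D.circle w (D.underIn c)) + gen R t (D.circle w (D.underOut c))
  else 1

/-- The map along an edge of the cube from `v` to `w`, changing the smoothing at `c`: the
multiplication of `A` in the two factors merged, or the comultiplication in the factor of the circle
that splits.  Since `Δ(a) = (a ⊗ 1) Δ(1) = (1 ⊗ a) Δ(1)`, the comultiplication is the algebra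
homomorphism which puts `a` in one of the two new factors, followed by multiplication by `Δ(1)`. -/
def edgeMap (v w : D.Vertex) (c : Fin D.n) : D.VertexModule R t v →ₗ[R] D.VertexModule R t w :=
  LinearMap.mulRight R (D.edgeFactor R t v w c) ∘ₗ
    (tensorMap R t fun s : D.Circle v => D.circle w (D.firstEdge s)).toLinearMap

/-- The sum of all modules of the cube. -/
abbrev Chain : Type := ∀ v : D.Vertex, D.VertexModule R t v

/-- Number of `1`-smoothings at crossings before `c`. -/
def precede (v : D.Vertex) (c : Fin D.n) : ℕ :=
  (Finset.univ.filter fun c' => c' < c ∧ v c' = true).card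

/-- The differential of the total complex of the cube: its component at `w` is the sum over the
crossings `c` with `w c = 1` of the signed maps along the edges of the cube ending at `w`. -/
def differential : D.Chain R t →ₗ[R] D.Chain R t :=
  LinearMap.pi fun w => ∑ c ∈ Finset.univ.filter (fun c => w c = true),
    ((-1 : ℤ) ^ D.precede w c) •
      (D.edgeMap R t (Function.update w c false) w c ∘ₗ LinearMap.proj (Function.update w c false))

/-- The cycles of cohomological degree `i`; a vertex `v` is in cohomological degree
`weight v - n₋`. -/
def cycles (i : ℤ) : Submodule R (D.Chain R t) where
  carrier := {x | D.differential R t x = 0 ∧ ∀ v, (D.weight v : ℤ) - D.nNeg ≠ i → x v = 0}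
  zero_mem' := by simp
  add_mem' := by
    rintro x y ⟨hx, hx'⟩ ⟨hy, hy'⟩
    exact ⟨by simp [hx, hy], fun v hv => by simp [hx' v hv, hy' v hv]⟩
  smul_mem' := by
    rintro a x ⟨hx, hx'⟩
    exact ⟨by simp [hx], fun v hv => by simp [hx' v hv]⟩

/-- The cohomology in degree `i`: cycles modulo boundaries. -/
abbrev Cohomology (i : ℤ) : Type :=
  D.cycles R t i ⧸ (LinearMap.range (D.differential R t)).submoduleOf (D.cycles R t i)

/-- The cohomology in degree `i` modulo its `R`-torsion. -/
abbrev CohomologyModTorsion (i : ℤ) : Type :=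
  D.Cohomology R t i ⧸ Submodule.torsion R (D.Cohomology R t i)

/-! ### The action of `X` -/

/-- The action of `X` on the complex: at each vertex, multiplication by `X` in the factor of the
circle through the base point. -/
def xChain : D.Chain R t →ₗ[R] D.Chain R t :=
  LinearMap.pi fun v => LinearMap.mulRight R (gen R t (D.circle v 0)) ∘ₗ LinearMap.proj v

lemma xChain_apply (x : D.Chain R t) (v : D.Vertex) :
    D.xChain R t x v = x v * gen R t (D.circle v 0) := rfl

lemma edgeMap_mul_gen (v w : D.Vertex) (c : Fin D.n) (a : D.VertexModule R t v) :
    D.edgeMap R t v w c (a * gen R t (D.circle v 0)) =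
      D.edgeMap R t v w c a * gen R t (D.circle w 0) := by
  simp only [edgeMap, LinearMap.comp_apply, AlgHom.toLinearMap_apply, LinearMap.mulRight_apply,
    map_mul, tensorMap_gen, firstEdge_circle_zero]
  ring

lemma differential_xChain (x : D.Chain R t) :
    D.differential R t (D.xChain R t x) = D.xChain R t (D.differential R t x) := by
  funext w
  simp only [differential, LinearMap.pi_apply, LinearMap.sum_apply, LinearMap.smul_apply,
    LinearMap.comp_apply, LinearMap.proj_apply, xChain_apply, edgeMap_mul_gen, Finset.sum_mul,
    smul_mul_assoc]

lemma xChain_mem_cycles (i : ℤ) (x : D.Chain R t) (hx : x ∈ D.cycles R t i) :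
    D.xChain R t x ∈ D.cycles R t i :=
  ⟨by rw [differential_xChain, hx.1, map_zero],
    fun v hv => by rw [xChain_apply, hx.2 v hv, zero_mul]⟩

/-- The action of `X` on cohomology. -/
def xCohomology (i : ℤ) : D.Cohomology R t i →ₗ[R] D.Cohomology R t i :=
  Submodule.mapQ _ _ ((D.xChain R t).restrict (D.xChain_mem_cycles R t i)) (by
    rintro ⟨x, hx⟩ ⟨y, hy⟩
    exact ⟨D.xChain R t y, by rw [differential_xChain, hy]; rfl⟩)

/-- The action of `X` on cohomology modulo torsion. -/
def xModTorsion (i : ℤ) : D.CohomologyModTorsion R t i →ₗ[R] D.CohomologyModTorsion R t i :=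
  Submodule.mapQ _ _ (D.xCohomology R t i) (by
    intro x hx
    obtain ⟨a, ha⟩ := (Submodule.mem_torsion_iff x).1 hx
    exact (Submodule.mem_torsion_iff _).2 ⟨a, by
      change (a : R) • D.xCohomology R t i x = 0
      rw [← map_smul]
      exact (congrArg _ ha).trans (map_zero _)⟩)

/-! ### The theory over `ℚ[t]` -/

/-- `H'` in cohomological degree `i`: the cohomology of the complex over `ℚ[t]`, with
`A = ℚ[t][X]/(X² - t)`, modulo its `ℚ[t]`-torsion.  As a type of its own it is regarded as a module
over `ℚ[X]`, the variable `X` acting by `xModTorsion`. -/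
abbrev HPrime (i : ℤ) : Type :=
  Module.AEval' ((D.xModTorsion ℚ[X] Polynomial.X i).restrictScalars ℚ)

/-- The class in `H'` of a cycle. -/
def hPrimeClass (i : ℤ) (z : D.cycles ℚ[X] Polynomial.X i) : D.HPrime i :=
  Module.AEval'.of _ (Submodule.Quotient.mk (Submodule.Quotient.mk z))

/-- The product `∏_{s ∈ T} X_s`: the element of `A^{⊗ S}` with factors `X` at the indices in `T` and
factors `1` at all others. -/
def monomial {S : Type} (T : Finset S) : TensorPower R t S := ∏ s ∈ T, gen R t s

/-- The chains of `q`-degree `j`.  Here `t` has degree `4`, the elements `1` and `X` of each factor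
`A` have degrees `-1` and `1`, and the vertex `v` carries the shift `- weight v - n₊ + 2 n₋`. -/
def chainsOfDegree (j : ℤ) : Submodule ℚ (D.Chain ℚ[X] Polynomial.X) :=
  Submodule.pi Set.univ fun v => Submodule.span ℚ
    {x | ∃ (a : ℕ) (T : Finset (D.Circle v)),
      4 * (a : ℤ) + 2 * T.card - D.numCircles v - D.weight v - D.nPos + 2 * D.nNeg = j ∧
      x = (Polynomial.X ^ a : ℚ[X]) • monomial ℚ[X] Polynomial.X T}

/-- The elements of `H'` in cohomological degree `i` and `q`-degree `j`. -/
def hPrimeOfDegree (i j : ℤ) : Set (D.HPrime i) :=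
  {ξ | ∃ z : D.cycles ℚ[X] Polynomial.X i,
    (z : D.Chain ℚ[X] Polynomial.X) ∈ D.chainsOfDegree j ∧ D.hPrimeClass i z = ξ}

/-- The elements of degree `j` in the graded `ℚ[X]`-module `ℚ[X]{k}`, in which `X ^ m` has degree
`2 m + k`. -/
def shiftedPolynomialsOfDegree (k j : ℤ) : Set ℚ[X] :=
  {p | ∀ m : ℕ, p.coeff m ≠ 0 → 2 * (m : ℤ) + k = j}

/-! ### Rasmussen's invariant

Lee's complex is the complex with `R = ℚ` and `t = 1`.  Here `1` and `X` are the elements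
`v₊` and `v₋` of degrees `1` and `-1`, and the degree of a tensor at the vertex `v` is
shifted by `weight v + n₊ - 2 n₋`. -/

/-- The `k`-th step of the descending filtration of Lee's complex: the chains all of whose
homogeneous components have degree at least `k`. -/
def leeFiltration (k : ℤ) : Submodule ℚ (D.Chain ℚ 1) :=
  Submodule.pi Set.univ fun v => Submodule.span ℚ
    {x | ∃ T : Finset (D.Circle v),
      k ≤ (D.numCircles v : ℤ) - 2 * T.card + D.weight v + D.nPos - 2 * D.nNeg ∧
      x = monomial ℚ 1 T}

/-- Lee's homology, in all homological degrees together. -/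
abbrev LeeHomology : Type :=
  LinearMap.ker (D.differential ℚ 1) ⧸
    (LinearMap.range (D.differential ℚ 1)).submoduleOf (LinearMap.ker (D.differential ℚ 1))

/-- The induced filtration of Lee's homology: the classes represented by cycles in the `k`-th step
of the filtration of the complex. -/
def leeHomologyFiltration (k : ℤ) : Submodule ℚ D.LeeHomology :=
  ((D.leeFiltration k).submoduleOf (LinearMap.ker (D.differential ℚ 1))).map (Submodule.mkQ _)

/-- The filtration degrees of the nonzero classes in Lee's homology; the filtration degree of a
class is the largest `k` such that the class lies in the `k`-th step. -/
def leeDegrees : Set ℤ :=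
  {k | ∃ ξ : D.LeeHomology, ξ ≠ 0 ∧ IsGreatest {j | ξ ∈ D.leeHomologyFiltration j} k}

/-- `s` is Rasmussen's invariant: the smallest filtration degree `s_min` and the largest one `s_max`
of nonzero classes in Lee's homology are `s - 1` and `s + 1`. -/
def IsRasmussenInvariant (s : ℤ) : Prop :=
  IsLeast D.leeDegrees (s - 1) ∧ IsGreatest D.leeDegrees (s + 1)

end GaussCode

/-- A diagram of an oriented knot with a base point: a planar Gauss code. -/
structure KnotDiagram extends GaussCode where
  planar : toGaussCode.IsPlanar

end

/-!
The proof determines `H'` and Lee's homology from one algebraic number: the value of a cycle at the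
oriented resolution under a character of the tensor power.

*Topology.* Planarity is used once, for Gauss' parity condition: the two passages at a crossing
happen at times of different parity (`GaussCode.IsPlanar.isEven`).  It comes from a checkerboard
colouring of the faces, which exists by a dimension count over `ℤ/2`.  For an even code, orienting
the edges alternately forwards and backwards orients the circles of every resolution coherently, so
they are the cycles of a permutation, and changing a smoothing multiplies this permutation by a
transposition.  Hence each edge of the cube is a merge or a split and changes the number of circles
by one (`Adj.circle_iff`, `Adj.numCircles_merge`); the sign of the permutation of the oriented
resolution gives the parity of the `q`-degrees (`odd_numCircles_add_weight`).

*Characters.* Over an extension in which `t` has a nonzero square root, the characters of `A^{⊗ S}`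
are given by the sign functions on `S`, and they separate points (`RootExtension.eq_zero_of_eval`).
A sign function on the circles of a resolution is a colouring of the edges of the diagram, and edge
maps act on the part of a given colour by scalars (`RootExtension.edgeEval_edgeMap`).  So identities
between edge maps reduce to identities between scalars.

*Homotopies.* The reverse edge maps at a crossing form a homotopy from `X_e + X_{e'}` to zero, where
`e` and `e'` are the edges before and after a passage (`RootExtension.differential_homotopy_add`).
So `X_e` acts on cohomology as `(-1) ^ e X`, and the product over all edges of
`X_e + (-1) ^ e X_0` acts as `± (2 X) ^ (2 n + 1)`.  On chains this product annihilates every colour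
but the alternating one and its negative, which occur at the oriented resolution only.  Hence a
cycle whose values there vanish is a boundary up to powers of `2` and `t`
(`RootExtension.smul_mem_range_of_value_eq_zero`).

*Over `ℚ[t]`.*  With the square root `X` of `t`, the value embeds `H'` in degree `0` into `ℚ[X]`,
as an ideal containing a power of `X`; so the ideal is `(X ^ m)`, and it is generated by the value
of a homogeneous cycle `z₀` (`exists_generator`, `exists_equiv_hPrime`).

*Lee's complex.*  At `t = 1` the values `X ↦ ±1` detect homology, which is spanned by the classes of
the specializations of `z₀` and `X z₀`.  A Lee cycle of filtration degree at least `k` is the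
specialization of the sum of a homogeneous cycle of `q`-degree `-k` or `-k - 1`, whichever is odd,
and one of `q`-degree lower by two (`exists_specializeChain_add`,
`eq_zero_of_specializeChain_add`).  Their values are multiples of `X ^ m`, which bounds the degrees
and shows that the two classes have filtration degrees `s' + 1` and `s' - 1`
(`isRasmussenInvariant`).
-/

noncomputable section

/-! ### Orbits of a permutation multiplied by a transposition -/

namespace Equiv.Perm

variable {α : Type*}

/-- The cycles of a permutation, with the fixed points as cycles of length one. -/
abbrev Orbits (σ : Perm α) : Type _ := Quotient (SameCycle.setoid σ)

/-- The number of cycles of a permutation, fixed points included. -/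
noncomputable def numOrbits (σ : Perm α) : ℕ := Nat.card σ.Orbits

lemma orbits_mk_eq {σ : Perm α} {a b : α} :
    (Quotient.mk _ a : σ.Orbits) = Quotient.mk _ b ↔ SameCycle σ a b := Quotient.eq

lemma SameCycle.lift_eq [Finite α] {σ : Perm α} {β : Sort*} {f : α → β} (hf : ∀ a, f (σ a) = f a)
    {a b : α} (h : SameCycle σ a b) : f a = f b := by
  obtain ⟨n, rfl⟩ := h.exists_nat_pow_eq
  induction n with
  | zero => rfl
  | succ n ih => rw [pow_succ', Perm.mul_apply, hf]; exact ih ⟨n, by simp⟩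

variable [DecidableEq α]

lemma mul_swap_apply_of_ne {σ : Perm α} {x y a : α} (hx : a ≠ x) (hy : a ≠ y) :
    (σ * swap x y) a = σ a := by
  rw [Perm.mul_apply, swap_apply_of_ne_of_ne hx hy]

/-- The new cycle of `x` follows `σ` from `σ y`, and without meeting `x` it has to come back
to `y`. -/
lemma sameCycle_mul_swap_of_not [Finite α] {σ : Perm α} {x y : α} (h : ¬ SameCycle σ x y) :
    SameCycle (σ * swap x y) x y := by
  by_contra hS
  have key : ∀ k : ℕ, SameCycle (σ * swap x y) x ((σ ^ (k + 1)) y) := by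
    intro k
    induction k with
    | zero =>
      have : (σ * swap x y) x = (σ ^ (0 + 1)) y := by simp
      rw [← this, sameCycle_apply_right]
    | succ k ih =>
      have h1 : (σ ^ (k + 1)) y ≠ x := by
        intro h'
        exact h (SameCycle.symm ⟨(k + 1 : ℕ), by rw [zpow_natCast]; exact h'⟩)
      have h2 : (σ ^ (k + 1)) y ≠ y := by
        intro h'
        rw [h'] at ih
        exact hS ih
      rw [pow_succ' σ (k + 1), Perm.mul_apply, ← mul_swap_apply_of_ne h1 h2,
        sameCycle_apply_right]
      exact ih
  have := key (orderOf σ - 1)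
  rw [Nat.sub_add_cancel (orderOf_pos σ), pow_orderOf_eq_one] at this
  exact hS this

/-- If `σ ^ k` maps `x` to `y` with `k` minimal, then `σ x, …, σ ^ k x = y` is a cycle of
`σ * swap x y`, and it avoids `x`. -/
lemma not_sameCycle_mul_swap [Finite α] {σ : Perm α} {x y : α} (hxy : x ≠ y)
    (h : SameCycle σ x y) : ¬ SameCycle (σ * swap x y) x y := by
  classical
  have hex := h.exists_nat_pow_eq
  set k := Nat.find hex with hk
  have hk1 : (σ ^ k) x = y := Nat.find_spec hex
  have hmin : ∀ j < k, (σ ^ j) x ≠ y := fun j hj => Nat.find_min hex hj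
  have hk0 : k ≠ 0 := by
    intro h0
    rw [h0] at hk1
    exact hxy hk1
  have hx : ∀ j, 0 < j → j ≤ k → (σ ^ j) x ≠ x := by
    intro j hj hjk hjx
    refine hmin (k - j) (by omega) ?_
    rw [← hk1]
    conv_rhs => rw [show k = (k - j) + j by omega, pow_add, Perm.mul_apply, hjx]
  have key : ∀ i : ℕ, ∃ j, 0 < j ∧ j ≤ k ∧ ((σ * swap x y) ^ i) y = (σ ^ j) x := by
    intro i
    induction i with
    | zero => exact ⟨k, by omega, le_rfl, hk1.symm⟩
    | succ i ih =>
      obtain ⟨j, hj, hjk, hij⟩ := ih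
      rw [pow_succ', Perm.mul_apply, hij]
      rcases eq_or_ne j k with rfl | hne
      · exact ⟨1, one_pos, by omega, by rw [hk1]; simp⟩
      · refine ⟨j + 1, by omega, by omega, ?_⟩
        rw [mul_swap_apply_of_ne (hx j hj hjk) (hmin j (by omega)), pow_succ', Perm.mul_apply]
  intro hS
  obtain ⟨i, hi⟩ := hS.symm.exists_nat_pow_eq
  obtain ⟨j, hj, hjk, hij⟩ := key i
  exact hx j hj hjk (by rw [← hij, hi])

/-- Composition with a transposition of points on different cycles merges the two cycles. -/
lemma numOrbits_mul_swap_add_one [Finite α] {σ : Perm α} {x y : α} (h : ¬ SameCycle σ x y) :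
    numOrbits (σ * swap x y) + 1 = numOrbits σ := by
  classical
  have hS := sameCycle_mul_swap_of_not h
  set τ := σ * swap x y with hτ
  have hτx : τ x = σ y := by simp [hτ]
  have hτy : τ y = σ x := by simp [hτ]
  -- the map replacing the cycle of `x` by the cycle of `y`
  let f : α → σ.Orbits := fun a =>
    if (Quotient.mk _ a : σ.Orbits) = Quotient.mk _ x then Quotient.mk _ y else Quotient.mk _ a
  have mkσ : ∀ a, (Quotient.mk _ (σ a) : σ.Orbits) = Quotient.mk _ a := fun a =>
    orbits_mk_eq.2 (sameCycle_apply_left.2 (SameCycle.refl _ _))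
  have hfσ : ∀ a, f (σ a) = f a := fun a => by simp only [f, mkσ]
  have hfx : f x = Quotient.mk _ y := by simp [f]
  have hfy : f y = Quotient.mk _ y := by simp [f]
  have hf : ∀ a, f (τ a) = f a := by
    intro a
    rcases eq_or_ne a x with rfl | hax
    · rw [hτx, hfσ, hfx, hfy]
    rcases eq_or_ne a y with rfl | hay
    · rw [hτy, hfσ, hfx, hfy]
    rw [hτ, mul_swap_apply_of_ne hax hay, hfσ]
  have mkτ : ∀ a, (Quotient.mk _ (τ a) : τ.Orbits) = Quotient.mk _ a := fun a =>
    orbits_mk_eq.2 (sameCycle_apply_left.2 (SameCycle.refl _ _))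
  have hxyτ : (Quotient.mk _ x : τ.Orbits) = Quotient.mk _ y := orbits_mk_eq.2 hS
  have hback : ∀ a, (Quotient.mk _ (σ a) : τ.Orbits) = Quotient.mk _ a := by
    intro a
    rcases eq_or_ne a x with rfl | hax
    · rw [← hτy, mkτ, hxyτ]
    rcases eq_or_ne a y with rfl | hay
    · rw [← hτx, mkτ, hxyτ]
    rw [← mul_swap_apply_of_ne (σ := σ) hax hay, mkτ]
  have hyx : (Quotient.mk _ y : σ.Orbits) ≠ Quotient.mk _ x := fun h' =>
    h (orbits_mk_eq.1 h').symm
  have hne : ∀ a, f a ≠ Quotient.mk _ x := by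
    intro a
    simp only [f]
    split_ifs with h'
    · exact hyx
    · exact h'
  let F : τ.Orbits → {q : σ.Orbits // q ≠ Quotient.mk _ x} :=
    Quotient.lift (fun a => ⟨f a, hne a⟩) fun a b hab =>
      Subtype.ext (SameCycle.lift_eq hf hab)
  have hF : Function.Bijective F := by
    constructor
    · intro p q
      induction p using Quotient.inductionOn with | _ a
      induction q using Quotient.inductionOn with | _ b
      intro hab
      have hab' : f a = f b := congrArg Subtype.val hab
      have toτ : ∀ a b, (Quotient.mk _ a : σ.Orbits) = Quotient.mk _ b →
          (Quotient.mk _ a : τ.Orbits) = Quotient.mk _ b := fun a b h' =>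
        SameCycle.lift_eq (f := fun a => (Quotient.mk _ a : τ.Orbits)) hback (orbits_mk_eq.1 h')
      simp only [f] at hab'
      split_ifs at hab' with h1 h2 h2
      · rw [toτ _ _ h1, toτ _ _ h2]
      · rw [toτ _ _ h1, hxyτ, toτ _ _ hab']
      · rw [toτ _ _ h2, hxyτ, toτ _ _ hab']
      · exact toτ _ _ hab'
    · rintro ⟨q, hq⟩
      induction q using Quotient.inductionOn with | _ a
      exact ⟨Quotient.mk _ a, Subtype.ext (if_neg hq)⟩
  rw [numOrbits, Nat.card_eq_of_bijective F hF, numOrbits]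
  have := Fintype.ofFinite σ.Orbits
  rw [Nat.card_eq_fintype_card, Nat.card_eq_fintype_card, Fintype.card_subtype_compl,
    Fintype.card_subtype_eq]
  have : 0 < Fintype.card σ.Orbits := Fintype.card_pos_iff.2 ⟨Quotient.mk _ x⟩
  omega

lemma sign_eq_neg_one_pow_numOrbits [Fintype α] (σ : Perm α) :
    sign σ = (-1) ^ (numOrbits σ + Fintype.card α) := by
  induction σ using swap_induction_on' with
  | one =>
    have : numOrbits (1 : Perm α) = Fintype.card α := by
      rw [numOrbits, ← Nat.card_eq_fintype_card]
      refine (Nat.card_eq_of_bijective (fun a : α => (Quotient.mk _ a : (1 : Perm α).Orbits))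
        ⟨fun a b h => sameCycle_one.1 (orbits_mk_eq.1 h), Quotient.mk_surjective⟩).symm
    rw [this, sign_one, ← two_mul, pow_mul]
    simp
  | mul_swap f x y hxy ih =>
    rw [sign_mul, sign_swap hxy, ih]
    by_cases h : SameCycle f x y
    · have h1 := numOrbits_mul_swap_add_one (not_sameCycle_mul_swap hxy h)
      rw [mul_assoc, swap_mul_self, mul_one] at h1
      rw [← h1, show numOrbits f + 1 + Fintype.card α = numOrbits f + Fintype.card α + 1 by ring,
        pow_succ]
    · rw [← numOrbits_mul_swap_add_one h, show numOrbits (f * swap x y) + 1 + Fintype.card α =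
        numOrbits (f * swap x y) + Fintype.card α + 1 by ring, pow_succ, mul_assoc]
      simp

end Equiv.Perm

/-! ### Checkerboard colouring and Gauss' parity condition -/

namespace GaussCode

variable {D : GaussCode}

/-- Gauss' parity condition: between the two passages at any crossing there is an even number of
further passages. -/
def IsEven (D : GaussCode) : Prop :=
  ∀ c : Fin D.n, Odd ((D.visit (Sum.inl c) : ℕ) + D.visit (Sum.inr c))

instance : Finite D.Face := Finite.of_surjective _ Quot.mk_surjective

/-- The face on the given side of an edge. -/
def face (e : D.Edge) (b : Bool) : D.Face := Quot.mk _ (e, b)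

lemma passage_cases {motive : D.Edge → D.Edge → Prop}
    (lower : ∀ c, motive (D.underIn c) (D.underOut c))
    (upper : ∀ c, motive (D.overIn c) (D.overOut c)) (k : Fin (2 * D.n)) :
    motive k.castSucc k.succ := by
  obtain ⟨c | c, rfl⟩ := D.visit.surjective k
  · exact lower c
  · exact upper c

/-- The difference of the values of a function of the faces across an edge. -/
def jump (f : D.Face → ZMod 2) (e : D.Edge) : ZMod 2 := f (face e false) + f (face e true)

lemma corner_pos (c : Fin D.n) (h : D.positive c = true) :
    face (D.underIn c) true = face (D.overOut c) true ∧
    face (D.overOut c) false = face (D.underOut c) true ∧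
    face (D.underOut c) false = face (D.overIn c) false ∧
    face (D.overIn c) true = face (D.underIn c) false :=
  ⟨Quot.sound (.pos₁ c h), Quot.sound (.pos₂ c h), Quot.sound (.pos₃ c h),
    Quot.sound (.pos₄ c h)⟩

lemma corner_neg (c : Fin D.n) (h : D.positive c = false) :
    face (D.underIn c) true = face (D.overIn c) false ∧
    face (D.overIn c) true = face (D.underOut c) true ∧
    face (D.underOut c) false = face (D.overOut c) true ∧
    face (D.overOut c) false = face (D.underIn c) false :=
  ⟨Quot.sound (.neg₁ c h), Quot.sound (.neg₂ c h), Quot.sound (.neg₃ c h),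
    Quot.sound (.neg₄ c h)⟩

/-- The jumps across the four edges at a crossing sum to zero: if those across the lower strand
agree, so do those across the upper strand. -/
lemma jump_over {f : D.Face → ZMod 2} {c : Fin D.n}
    (h : jump f (D.underIn c) = jump f (D.underOut c)) :
    jump f (D.overIn c) = jump f (D.overOut c) := by
  have key : ∀ a b c d : ZMod 2, d + a = c + b → a + b = d + c := by decide
  have key' : ∀ a b c d : ZMod 2, d + a = c + b → c + d = b + a := by decide
  cases hc : D.positive c
  · obtain ⟨h1, h2, h3, h4⟩ := corner_neg c hc
    simp only [jump, ← h1, h2, h3, h4] at h ⊢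
    exact key _ _ _ _ h
  · obtain ⟨h1, h2, h3, h4⟩ := corner_pos c hc
    simp only [jump, h1, h2, h3, h4] at h ⊢
    exact key' _ _ _ _ h

lemma jump_eq_jump_zero {f : D.Face → ZMod 2}
    (h : ∀ c, jump f (D.underIn c) = jump f (D.underOut c)) (e : D.Edge) :
    jump f e = jump f 0 := by
  induction e using Fin.induction with
  | zero => rfl
  | succ k ih =>
    rw [← ih]
    exact passage_cases (motive := fun a b => jump f b = jump f a) (fun c => (h c).symm)
      (fun c => (jump_over (h c)).symm) k

/-- A function of the faces without jumps is constant. -/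
lemma eq_const_of_jump_eq_zero {f : D.Face → ZMod 2} (h : ∀ e, jump f e = 0) (x y : D.Face) :
    f x = f y := by
  have hs : ∀ e, f (face e false) = f (face e true) := fun e => by
    have key : ∀ a b : ZMod 2, a + b = 0 → a = b := by decide
    exact key _ _ (h e)
  have h0 : ∀ e : D.Edge, f (face e true) = f (face 0 true) := by
    intro e
    induction e using Fin.induction with
    | zero => rfl
    | succ k ih =>
      rw [← ih]
      refine passage_cases (motive := fun a b => f (face b true) = f (face a true)) ?_ ?_ k
      all_goals
        intro c
        cases hc : D.positive c
        · obtain ⟨h1, h2, h3, h4⟩ := corner_neg c hc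
          grind
        · obtain ⟨h1, h2, h3, h4⟩ := corner_pos c hc
          grind
  have h1 : ∀ x : D.Face, f x = f (face 0 true) := by
    intro x
    obtain ⟨⟨e, b⟩, rfl⟩ := Quot.mk_surjective x
    cases b
    · exact (hs e).trans (h0 e)
    · exact h0 e
  rw [h1 x, h1 y]

/-- In genus zero the faces can be coloured so that the two sides of each edge have different
colours.  The jumps of the functions of the faces form a subspace of the cycle space of the graph;
both have dimension `n + 1`. -/
lemma exists_checkerboard (hD : D.IsPlanar) : ∃ f : D.Face → ZMod 2, ∀ e, jump f e = 1 := by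
  classical
  have := Fintype.ofFinite D.Face
  let ψ : (D.Face → ZMod 2) →ₗ[ZMod 2] (Option (Fin D.n) → ZMod 2) :=
    { toFun := fun f i => i.elim (jump f 0) fun c => jump f (D.underIn c) + jump f (D.underOut c)
      map_add' := by
        intro f g
        ext (_ | c) <;> simp only [jump, Option.elim, Pi.add_apply] <;> ring
      map_smul' := by
        intro a f
        ext (_ | c) <;> simp only [jump, Option.elim, Pi.smul_apply, smul_eq_mul,
          RingHom.id_apply] <;> ring }
  have hψ : ∀ f, (∀ c, ψ f (some c) = 0) → ∀ e, jump f e = ψ f none := by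
    intro f h
    have key : ∀ a b : ZMod 2, a + b = 0 → a = b := by decide
    exact jump_eq_jump_zero fun c => key _ _ (h c)
  have hker : Module.finrank (ZMod 2) (LinearMap.ker ψ) ≤ 1 := by
    refine finrank_le_one (⟨fun _ => 1, ?_⟩ : LinearMap.ker ψ) ?_
    · ext (_ | c) <;> simp only [ψ, jump, LinearMap.coe_mk, AddHom.coe_mk, Option.elim] <;> rfl
    · rintro ⟨f, hf⟩
      refine ⟨f (face 0 true), Subtype.ext (funext fun x => ?_)⟩
      have h0 := congrFun (LinearMap.mem_ker.1 hf)
      have : f x = f (face 0 true) := eq_const_of_jump_eq_zero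
        (fun e => (hψ f (fun c => h0 _) e).trans (h0 none)) _ _
      simp [this]
  have hdim := LinearMap.finrank_range_add_finrank_ker ψ
  rw [Module.finrank_fintype_fun_eq_card, ← Nat.card_eq_fintype_card, hD] at hdim
  have hsurj : LinearMap.range ψ = ⊤ := by
    apply Submodule.eq_top_of_finrank_eq
    apply le_antisymm (Submodule.finrank_le _)
    rw [Module.finrank_fintype_fun_eq_card, Fintype.card_option, Fintype.card_fin]
    omega
  obtain ⟨f, hf⟩ := LinearMap.range_eq_top.1 hsurj fun i => i.elim 1 fun _ => 0
  exact ⟨f, fun e => by rw [hψ f (fun c => by rw [hf]; rfl), hf]; rfl⟩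

/-- Along the curve, the colour on the right-hand side changes at each passage, and at a crossing
the two incoming edges have different colours on their right. -/
theorem IsPlanar.isEven (hD : D.IsPlanar) : D.IsEven := by
  obtain ⟨f, hf⟩ := exists_checkerboard hD
  have hc : ∀ c, f (face (D.underOut c) true) = f (face (D.underIn c) true) + 1 ∧
      f (face (D.overOut c) true) = f (face (D.overIn c) true) + 1 ∧
      f (face (D.overIn c) true) = f (face (D.underIn c) true) + 1 := by
    intro c
    have key_neg : ∀ a b c d : ZMod 2, d + a = 1 → c + b = 1 → a + b = 1 → d + c = 1 →
        b = a + 1 ∧ c = b + 1 ∧ b = a + 1 := by decide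
    have key_pos : ∀ a b c d : ZMod 2, d + a = 1 → c + b = 1 → c + d = 1 → b + a = 1 →
        b = a + 1 ∧ a = d + 1 ∧ d = a + 1 := by decide
    have h1 := hf (D.underIn c)
    have h2 := hf (D.underOut c)
    have h3 := hf (D.overIn c)
    have h4 := hf (D.overOut c)
    cases hp : D.positive c
    · obtain ⟨e1, e2, e3, e4⟩ := corner_neg c hp
      simp only [jump, ← e1, e2, e3, e4] at h1 h2 h3 h4 ⊢
      exact key_neg _ _ _ _ h1 h2 h3 h4
    · obtain ⟨e1, e2, e3, e4⟩ := corner_pos c hp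
      simp only [jump, e1, e2, e3, e4] at h1 h2 h3 h4 ⊢
      exact key_pos _ _ _ _ h1 h2 h3 h4
  have halt : ∀ e : D.Edge, f (face e true) = f (face 0 true) + (e : ℕ) := by
    intro e
    induction e using Fin.induction with
    | zero => simp
    | succ k ih =>
      have : f (face k.succ true) = f (face k.castSucc true) + 1 :=
        passage_cases (motive := fun a b => f (face b true) = f (face a true) + 1)
          (fun c => (hc c).1) (fun c => (hc c).2.1) k
      rw [this, ih]
      push_cast [Fin.val_succ, Fin.val_castSucc]
      ring
  intro c
  have h := (hc c).2.2
  rw [halt, halt (D.underIn c), add_assoc, add_left_cancel_iff] at h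
  rw [← Nat.not_even_iff_odd, ← ZMod.natCast_eq_zero_iff_even, Nat.cast_add]
  change ((D.underIn c : ℕ) : ZMod 2) + ((D.overIn c : ℕ) : ZMod 2) ≠ 0
  rw [h]
  generalize ((D.underIn c : ℕ) : ZMod 2) = a
  revert a
  decide

end GaussCode

/-! ### Circles of resolutions as cycles of permutations -/

namespace GaussCode

variable {D : GaussCode}

open Equiv Equiv.Perm

lemma underIn_val (c : Fin D.n) : (D.underIn c : ℕ) = D.visit (Sum.inl c) := rfl
lemma underOut_val (c : Fin D.n) : (D.underOut c : ℕ) = D.visit (Sum.inl c) + 1 := rfl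
lemma overIn_val (c : Fin D.n) : (D.overIn c : ℕ) = D.visit (Sum.inr c) := rfl
lemma overOut_val (c : Fin D.n) : (D.overOut c : ℕ) = D.visit (Sum.inr c) + 1 := rfl

/-- Orient the edges of even index forwards and those of odd index backwards.  For an even code the
two edges of one strand at `c` then point towards the crossing, those of the other strand away from
it.  This is the passage of the strand pointing towards the crossing. -/
def headVisit (c : Fin D.n) : Fin (2 * D.n) :=
  if Even (D.visit (Sum.inl c) : ℕ) then D.visit (Sum.inl c) else D.visit (Sum.inr c)

/-- The passage at `c` of the strand whose edges point away from the crossing in the alternating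
orientation. -/
def tailVisit (c : Fin D.n) : Fin (2 * D.n) :=
  if Even (D.visit (Sum.inl c) : ℕ) then D.visit (Sum.inr c) else D.visit (Sum.inl c)

lemma headVisit_even (hD : D.IsEven) (c : Fin D.n) : Even (D.headVisit c : ℕ) := by
  have := hD c
  unfold headVisit
  split_ifs with h <;> grind

lemma tailVisit_odd (hD : D.IsEven) (c : Fin D.n) : Odd (D.tailVisit c : ℕ) := by
  have := hD c
  unfold tailVisit
  split_ifs with h <;> grind

lemma headVisit_injective : Function.Injective D.headVisit := by
  intro c c' h
  unfold headVisit at h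
  split_ifs at h <;> simpa using D.visit.injective h

lemma tailVisit_injective : Function.Injective D.tailVisit := by
  intro c c' h
  unfold tailVisit at h
  split_ifs at h <;> simpa using D.visit.injective h

/-- The edges in terms of the place where they end in the alternating orientation: the base point,
or one of the two edges pointing towards a crossing. -/
def headEdge : Option (Fin D.n × Bool) → D.Edge
  | none => Fin.last _
  | some (c, false) => (D.headVisit c).castSucc
  | some (c, true) => (D.headVisit c).succ

/-- The edges in terms of the place where they start in the alternating orientation. -/
def tailEdge : Option (Fin D.n × Bool) → D.Edge
  | none => 0
  | some (c, false) => (D.tailVisit c).castSucc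
  | some (c, true) => (D.tailVisit c).succ

lemma headEdge_bijective (hD : D.IsEven) : Function.Bijective D.headEdge := by
  rw [Fintype.bijective_iff_injective_and_card]
  constructor
  · have hlt := fun c => (D.headVisit c).isLt
    have hev := headVisit_even hD
    have hinj : ∀ c c', (D.headVisit c : ℕ) = D.headVisit c' → c = c' := fun c c' h =>
      headVisit_injective (Fin.ext h)
    rintro (_ | ⟨c, _ | _⟩) (_ | ⟨c', _ | _⟩) h
    all_goals
      have h' := congrArg Fin.val h
      simp only [headEdge, Fin.val_last, Fin.val_castSucc, Fin.val_succ] at h'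
      grind
  · simp [mul_comm]

lemma tailEdge_bijective (hD : D.IsEven) : Function.Bijective D.tailEdge := by
  rw [Fintype.bijective_iff_injective_and_card]
  constructor
  · have hodd := tailVisit_odd hD
    have hinj : ∀ c c', (D.tailVisit c : ℕ) = D.tailVisit c' → c = c' := fun c c' h =>
      tailVisit_injective (Fin.ext h)
    rintro (_ | ⟨c, _ | _⟩) (_ | ⟨c', _ | _⟩) h
    all_goals
      have h' := congrArg Fin.val h
      simp only [tailEdge, Fin.val_zero, Fin.val_castSucc, Fin.val_succ] at h'
      grind
  · simp [mul_comm]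

/-- The way the incoming ends at the crossings are joined to the outgoing ones: straight in an
unoriented smoothing, crosswise in an oriented one. -/
def twist (v : D.Vertex) : Perm (Option (Fin D.n × Bool)) :=
  optionCongr (prodCongrRight fun c => if D.positive c = v c then 1 else boolNot)

lemma twist_some (v : D.Vertex) (c : Fin D.n) (b : Bool) :
    twist v (some (c, b)) = some (c, if D.positive c = v c then b else !b) := by
  simp only [twist, optionCongr_apply, Option.map_some, prodCongrRight_apply]
  split_ifs <;> rfl

/-- The permutation of the edges whose cycles are the circles of the resolution `v`, each run
through in the alternating orientation. -/
def circlePerm (hD : D.IsEven) (v : D.Vertex) : Perm D.Edge :=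
  (Equiv.ofBijective _ (headEdge_bijective hD)).symm.trans
    ((twist v).trans (Equiv.ofBijective _ (tailEdge_bijective hD)))

lemma circlePerm_headEdge (hD : D.IsEven) (v : D.Vertex) (i : Option (Fin D.n × Bool)) :
    circlePerm hD v (headEdge i) = tailEdge (twist v i) := by
  have : (Equiv.ofBijective _ (headEdge_bijective hD)).symm (headEdge i) = i :=
    (Equiv.ofBijective _ (headEdge_bijective hD)).symm_apply_apply i
  simp only [circlePerm, Equiv.trans_apply, this]
  rfl

/-- Either the lower strand points towards the crossing, or the upper one. -/
lemma strands_cases (c : Fin D.n) :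
    (headEdge (some (c, false)) = D.underIn c ∧ headEdge (some (c, true)) = D.underOut c ∧
      tailEdge (some (c, false)) = D.overIn c ∧ tailEdge (some (c, true)) = D.overOut c) ∨
    (headEdge (some (c, false)) = D.overIn c ∧ headEdge (some (c, true)) = D.overOut c ∧
      tailEdge (some (c, false)) = D.underIn c ∧ tailEdge (some (c, true)) = D.underOut c) := by
  by_cases h : Even (D.visit (Sum.inl c) : ℕ)
  · left
    simp only [headEdge, tailEdge, headVisit, tailVisit, if_pos h]
    exact ⟨rfl, rfl, rfl, rfl⟩
  · right
    simp only [headEdge, tailEdge, headVisit, tailVisit, if_neg h]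
    exact ⟨rfl, rfl, rfl, rfl⟩

lemma circle_base (v : D.Vertex) : D.circle v (Fin.last _) = D.circle v 0 :=
  Quot.sound .base

lemma circle_oriented {v : D.Vertex} {c : Fin D.n} (h : D.positive c ≠ v c) :
    D.circle v (D.underIn c) = D.circle v (D.overOut c) ∧
    D.circle v (D.overIn c) = D.circle v (D.underOut c) :=
  ⟨Quot.sound (.oriented₁ c h), Quot.sound (.oriented₂ c h)⟩

lemma circle_unoriented {v : D.Vertex} {c : Fin D.n} (h : D.positive c = v c) :
    D.circle v (D.underIn c) = D.circle v (D.overIn c) ∧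
    D.circle v (D.underOut c) = D.circle v (D.overOut c) :=
  ⟨Quot.sound (.unoriented₁ c h), Quot.sound (.unoriented₂ c h)⟩

lemma circle_circlePerm (hD : D.IsEven) (v : D.Vertex) (e : D.Edge) :
    D.circle v (circlePerm hD v e) = D.circle v e := by
  obtain ⟨i, rfl⟩ := (headEdge_bijective hD).surjective e
  rw [circlePerm_headEdge]
  rcases i with _ | ⟨c, b⟩
  · exact (circle_base v).symm
  rw [twist_some]
  by_cases h : D.positive c = v c
  · have h1 := circle_unoriented h
    rw [if_pos h]
    rcases strands_cases c with h2 | h2 <;> cases b <;> grind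
  · have h1 := circle_oriented h
    rw [if_neg h]
    rcases strands_cases c with h2 | h2 <;> cases b <;> simp only [Bool.not_false, Bool.not_true] <;>
      grind

lemma sameCycle_of_joined (hD : D.IsEven) {v : D.Vertex} {a b : D.Edge} (h : D.Joined v a b) :
    SameCycle (circlePerm hD v) a b := by
  have hs : ∀ i, SameCycle (circlePerm hD v) (headEdge i) (tailEdge (twist v i)) := fun i => by
    rw [← circlePerm_headEdge hD, sameCycle_apply_right]
  have key : ∀ c, ∀ b, SameCycle (circlePerm hD v) (headEdge (some (c, b)))
      (tailEdge (some (c, if D.positive c = v c then b else !b))) := fun c b => by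
    rw [← twist_some]; exact hs _
  cases h with
  | base => exact hs none
  | oriented₁ c h =>
    have h1 := key c false
    have h2 := key c true
    simp only [if_neg h, Bool.not_false, Bool.not_true] at h1 h2
    rcases strands_cases c with ⟨e1, e2, e3, e4⟩ | ⟨e1, e2, e3, e4⟩
    · rwa [e1, e4] at h1
    · rw [e2, e3] at h2; exact h2.symm
  | oriented₂ c h =>
    have h1 := key c false
    have h2 := key c true
    simp only [if_neg h, Bool.not_false, Bool.not_true] at h1 h2
    rcases strands_cases c with ⟨e1, e2, e3, e4⟩ | ⟨e1, e2, e3, e4⟩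
    · rw [e2, e3] at h2; exact h2.symm
    · rwa [e1, e4] at h1
  | unoriented₁ c h =>
    have h1 := key c false
    simp only [if_pos h] at h1
    rcases strands_cases c with ⟨e1, e2, e3, e4⟩ | ⟨e1, e2, e3, e4⟩
    · rwa [e1, e3] at h1
    · rw [e1, e3] at h1; exact h1.symm
  | unoriented₂ c h =>
    have h2 := key c true
    simp only [if_pos h] at h2
    rcases strands_cases c with ⟨e1, e2, e3, e4⟩ | ⟨e1, e2, e3, e4⟩
    · rwa [e2, e4] at h2
    · rw [e2, e4] at h2; exact h2.symm

/-- A permutation whose cycles are the classes of the joined edges has as many cycles as there are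
circles. -/
lemma numCircles_eq_numOrbits {v : D.Vertex} {σ : Perm D.Edge}
    (h₁ : ∀ a b, D.Joined v a b → SameCycle σ a b)
    (h₂ : ∀ e, D.circle v (σ e) = D.circle v e) : D.numCircles v = numOrbits σ := by
  rw [numCircles, ← Nat.card_eq_fintype_card]
  let F : D.Circle v → σ.Orbits := Quot.lift (Quotient.mk _) fun a b h => orbits_mk_eq.2 (h₁ a b h)
  refine Nat.card_eq_of_bijective F ⟨?_, ?_⟩
  · intro p q
    induction p using Quot.inductionOn with | _ a
    induction q using Quot.inductionOn with | _ b
    intro h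
    exact SameCycle.lift_eq h₂ (orbits_mk_eq.1 h)
  · intro q
    induction q using Quotient.inductionOn with | _ a
    exact ⟨D.circle v a, rfl⟩

lemma circle_eq_iff (hD : D.IsEven) {v : D.Vertex} {a b : D.Edge} :
    D.circle v a = D.circle v b ↔ SameCycle (circlePerm hD v) a b := by
  constructor
  · intro h
    have := congrArg (Quot.lift (fun e => (Quotient.mk _ e : (circlePerm hD v).Orbits))
      fun a b h => orbits_mk_eq.2 (sameCycle_of_joined hD h)) h
    exact orbits_mk_eq.1 this
  · exact SameCycle.lift_eq (circle_circlePerm hD v)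

lemma numCircles_eq (hD : D.IsEven) (v : D.Vertex) :
    D.numCircles v = numOrbits (circlePerm hD v) :=
  numCircles_eq_numOrbits (fun _ _ => sameCycle_of_joined hD) (circle_circlePerm hD v)

/-- Vertices which differ exactly at the crossing `c`. -/
def Adj (v w : D.Vertex) (c : Fin D.n) : Prop := w c = !(v c) ∧ ∀ c' ≠ c, w c' = v c'

lemma Adj.symm {v w : D.Vertex} {c : Fin D.n} (h : Adj v w c) : Adj w v c :=
  ⟨by rw [h.1, Bool.not_not], fun c' hc' => (h.2 c' hc').symm⟩

lemma circlePerm_of_adj (hD : D.IsEven) {v w : D.Vertex} {c : Fin D.n} (h : Adj v w c) :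
    circlePerm hD w = circlePerm hD v *
      swap (headEdge (some (c, false))) (headEdge (some (c, true))) := by
  have hinj := (headEdge_bijective hD).injective
  have hw : (D.positive c = w c) ↔ ¬ (D.positive c = v c) := by
    rw [h.1]; cases D.positive c <;> cases v c <;> decide
  ext1 e
  obtain ⟨i, rfl⟩ := (headEdge_bijective hD).surjective e
  rw [Perm.mul_apply]
  rcases i with _ | ⟨c', b⟩
  · rw [swap_apply_of_ne_of_ne (hinj.ne (by simp)) (hinj.ne (by simp)), circlePerm_headEdge,
      circlePerm_headEdge]
    rfl
  rcases eq_or_ne c' c with rfl | hc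
  · cases b
    · rw [swap_apply_left, circlePerm_headEdge, circlePerm_headEdge, twist_some, twist_some]
      simp only [hw]
      split_ifs <;> rfl
    · rw [swap_apply_right, circlePerm_headEdge, circlePerm_headEdge, twist_some, twist_some]
      simp only [hw]
      split_ifs <;> rfl
  · rw [swap_apply_of_ne_of_ne (hinj.ne (by simp [hc])) (hinj.ne (by simp [hc])),
      circlePerm_headEdge, circlePerm_headEdge, twist_some, twist_some, h.2 c' hc]

lemma circle_strands_iff (v : D.Vertex) (c : Fin D.n) :
    D.circle v (headEdge (some (c, false))) = D.circle v (headEdge (some (c, true))) ↔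
      D.circle v (D.underIn c) = D.circle v (D.underOut c) := by
  rcases strands_cases c with ⟨e1, e2, e3, e4⟩ | ⟨e1, e2, e3, e4⟩
  · rw [e1, e2]
  · rw [e1, e2]
    by_cases h : D.positive c = v c
    · rw [(circle_unoriented h).1, (circle_unoriented h).2]
    · rw [(circle_oriented h).1, (circle_oriented h).2, eq_comm]

/-- A change of smoothing is either a merge or a split, and its reverse is the other one. -/
lemma Adj.circle_iff (hD : D.IsEven) {v w : D.Vertex} {c : Fin D.n} (h : Adj v w c) :
    D.circle w (D.underIn c) = D.circle w (D.underOut c) ↔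
      ¬ D.circle v (D.underIn c) = D.circle v (D.underOut c) := by
  rw [← circle_strands_iff, ← circle_strands_iff, circle_eq_iff hD, circle_eq_iff hD,
    circlePerm_of_adj hD h]
  constructor
  · intro h1 h2
    exact not_sameCycle_mul_swap
      ((headEdge_bijective hD).injective.ne (by simp)) h2 h1
  · exact sameCycle_mul_swap_of_not

lemma Adj.numCircles_merge (hD : D.IsEven) {v w : D.Vertex} {c : Fin D.n} (h : Adj v w c)
    (hv : ¬ D.circle v (D.underIn c) = D.circle v (D.underOut c)) :
    D.numCircles w + 1 = D.numCircles v := by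
  rw [← circle_strands_iff, circle_eq_iff hD] at hv
  rw [numCircles_eq hD, numCircles_eq hD, circlePerm_of_adj hD h]
  exact numOrbits_mul_swap_add_one hv

lemma Adj.numCircles_split (hD : D.IsEven) {v w : D.Vertex} {c : Fin D.n} (h : Adj v w c)
    (hv : D.circle v (D.underIn c) = D.circle v (D.underOut c)) :
    D.numCircles w = D.numCircles v + 1 :=
  (h.symm.numCircles_merge hD (by rw [h.circle_iff hD]; simpa using hv)).symm

/-! ### Parity of the number of circles -/

/-- The oriented resolution. -/
def orientedVertex (D : GaussCode) : D.Vertex := fun c => !(D.positive c)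

lemma positive_ne_orientedVertex (c : Fin D.n) : D.positive c ≠ D.orientedVertex c := by
  simp [orientedVertex]

/-- The permutation whose cycles are the circles of the oriented resolution with their given
orientation: exchange the passages at all crossings, then move on to the next edge. -/
def orientedPerm (D : GaussCode) : Perm D.Edge :=
  finRotate _ * (finSuccEquivLast.symm.permCongr
    (optionCongr (D.visit.permCongr (sumComm (Fin D.n) (Fin D.n)))))

lemma orientedPerm_castSucc (s : Fin D.n ⊕ Fin D.n) :
    D.orientedPerm (D.visit s).castSucc = (D.visit s.swap).succ := by
  simp [orientedPerm, permCongr_apply]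

lemma orientedPerm_last : D.orientedPerm (Fin.last _) = 0 := by
  simp [orientedPerm, permCongr_apply]

lemma sign_sumComm_self {α : Type*} [Fintype α] [DecidableEq α] :
    sign (sumComm α α : Perm (α ⊕ α)) = (-1) ^ Fintype.card α := by
  have : (sumComm α α : Perm (α ⊕ α)) = (boolProdEquivSum α).permCongr
      (prodCongrLeft fun _ : α => boolNot) := by
    ext (a | a) <;> rfl
  rw [this, sign_permCongr, sign_prodCongrLeft]
  have h : sign boolNot = -1 := by decide
  simp [h]

lemma sign_orientedPerm : sign D.orientedPerm = (-1) ^ D.n := by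
  rw [orientedPerm, Perm.sign_mul, sign_finRotate, sign_permCongr, optionCongr_sign, sign_permCongr,
    sign_sumComm_self, Fintype.card_fin]
  simp

lemma numCircles_orientedVertex : D.numCircles D.orientedVertex = numOrbits D.orientedPerm := by
  apply numCircles_eq_numOrbits
  · intro a b h
    have hs : ∀ a, SameCycle D.orientedPerm a (D.orientedPerm a) := fun a =>
      sameCycle_apply_right.2 (SameCycle.refl _ _)
    cases h with
    | base => simpa only [orientedPerm_last] using hs (Fin.last _)
    | oriented₁ c h => exact (hs (D.underIn c)).trans ((orientedPerm_castSucc (Sum.inl c)).sameCycle _)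
    | oriented₂ c h => exact (hs (D.overIn c)).trans ((orientedPerm_castSucc (Sum.inr c)).sameCycle _)
    | unoriented₁ c h => exact absurd h (positive_ne_orientedVertex c)
    | unoriented₂ c h => exact absurd h (positive_ne_orientedVertex c)
  · intro e
    induction e using Fin.lastCases with
    | last => rw [orientedPerm_last, circle_base]
    | cast k =>
      obtain ⟨c | c, rfl⟩ := D.visit.surjective k
      · rw [orientedPerm_castSucc]
        exact (circle_oriented (positive_ne_orientedVertex c)).1.symm
      · rw [orientedPerm_castSucc]
        exact (circle_oriented (positive_ne_orientedVertex c)).2.symm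

lemma odd_numCircles_orientedVertex_add : Odd (D.numCircles D.orientedVertex + D.n) := by
  have h := sign_eq_neg_one_pow_numOrbits D.orientedPerm
  rw [sign_orientedPerm, ← numCircles_orientedVertex, Fintype.card_fin] at h
  by_contra hodd
  rw [Nat.not_odd_iff_even] at hodd
  have h1 : (-1 : ℤˣ) ^ (D.numCircles D.orientedVertex + (2 * D.n + 1)) = -(-1) ^ D.n := by
    rw [show D.numCircles D.orientedVertex + (2 * D.n + 1) =
      (D.numCircles D.orientedVertex + D.n) + D.n + 1 by ring, pow_succ, pow_add, hodd.neg_one_pow]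
    simp
  rw [h1] at h
  rcases neg_one_pow_eq_or ℤˣ D.n with h2 | h2 <;> rw [h2] at h <;> revert h <;> decide

lemma weight_update_true {v : D.Vertex} {c : Fin D.n} (h : v c = false) :
    D.weight (Function.update v c true) = D.weight v + 1 := by
  have : (Finset.univ.filter fun c' => Function.update v c true c' = true) =
      insert c (Finset.univ.filter fun c' => v c' = true) := by
    ext c'
    rcases eq_or_ne c' c with rfl | hc <;> simp [*]
  rw [weight, this, Finset.card_insert_of_notMem (by simp [h]), weight]

lemma weight_orientedVertex : D.weight D.orientedVertex = D.nNeg := by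
  simp [weight, nNeg, orientedVertex]

lemma nPos_add_nNeg : D.nPos + D.nNeg = D.n := by
  have := Finset.card_filter_add_card_filter_not (s := (Finset.univ : Finset (Fin D.n)))
    (fun c => D.positive c = true)
  simpa [nPos, nNeg] using this

lemma adj_update (v : D.Vertex) (c : Fin D.n) : Adj v (Function.update v c (!(v c))) c :=
  ⟨by simp, fun c' hc' => by simp [hc']⟩

/-- Changing a smoothing changes both the weight and the number of circles by one. -/
lemma even_numCircles_add_weight_iff (hD : D.IsEven) (v : D.Vertex) (c : Fin D.n) (b : Bool) :
    Even (D.numCircles (Function.update v c b) + D.weight (Function.update v c b)) ↔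
      Even (D.numCircles v + D.weight v) := by
  by_cases hb : b = v c
  · rw [hb, Function.update_eq_self]
  have hb' : b = !(v c) := by cases b <;> cases h : v c <;> simp_all
  subst hb'
  have hadj := adj_update v c
  have hw : D.weight (Function.update v c (!(v c))) = D.weight v + 1 ∨
      D.weight v = D.weight (Function.update v c (!(v c))) + 1 := by
    cases h : v c
    · exact Or.inl (weight_update_true h)
    · right
      have := weight_update_true (v := Function.update v c false) (c := c) (by simp)
      rw [Function.update_idem, ← h, Function.update_eq_self] at this
      simpa [h] using this
  by_cases hv : D.circle v (D.underIn c) = D.circle v (D.underOut c)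
  · have := hadj.numCircles_split hD hv
    grind
  · have := hadj.numCircles_merge hD hv
    grind

lemma even_numCircles_add_weight_iff_of_eqOn (hD : D.IsEven) (v w : D.Vertex)
    (s : Finset (Fin D.n)) (h : ∀ c ∉ s, v c = w c) :
    Even (D.numCircles v + D.weight v) ↔ Even (D.numCircles w + D.weight w) := by
  classical
  induction s using Finset.induction_on generalizing v with
  | empty => rw [funext fun c => h c (by simp)]
  | insert c s hc ih =>
    rw [← even_numCircles_add_weight_iff hD v c (w c)]
    apply ih
    intro c' hc'
    rcases eq_or_ne c' c with rfl | hne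
    · simp
    · rw [Function.update_of_ne hne, h c' (by simp [hne, hc'])]

lemma odd_numCircles_add_weight (hD : D.IsEven) (v : D.Vertex) :
    Odd (D.numCircles v + D.weight v + D.nPos) := by
  have h1 := even_numCircles_add_weight_iff_of_eqOn hD v D.orientedVertex Finset.univ (by simp)
  have h2 := odd_numCircles_orientedVertex_add (D := D)
  rw [weight_orientedVertex] at h1
  rw [← nPos_add_nNeg] at h2
  grind

end GaussCode

namespace GaussCode

/-! ### Characters of the tensor powers -/

section TensorPower

variable {R : Type} [CommRing R] {t : R} {S : Type}

lemma gen_mul_self (s : S) : gen R t s * gen R t s = t • (1 : TensorPower R t S) := by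
  rw [← sq, gen_sq, Algebra.algebraMap_eq_smul_one]

lemma monomial_mul_gen_of_notMem [DecidableEq S] {T : Finset S} {s : S} (h : s ∉ T) :
    monomial R t T * gen R t s = monomial R t (insert s T) := by
  rw [monomial, monomial, Finset.prod_insert h, mul_comm]

lemma monomial_mul_gen_of_mem [DecidableEq S] {T : Finset S} {s : S} (h : s ∈ T) :
    monomial R t T * gen R t s = t • monomial R t (T.erase s) := by
  rw [monomial, ← Finset.mul_prod_erase T _ h, mul_right_comm, gen_mul_self, smul_mul_assoc,
    one_mul, monomial]

/-- An additive subgroup of a tensor power which contains the constants and is closed under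
multiplication by the generators is everything. -/
lemma tensorPower_induction {U : AddSubgroup (TensorPower R t S)}
    (h₁ : ∀ r : R, r • (1 : TensorPower R t S) ∈ U)
    (h₂ : ∀ a ∈ U, ∀ s, a * gen R t s ∈ U) (a : TensorPower R t S) : a ∈ U := by
  obtain ⟨p, rfl⟩ := Ideal.Quotient.mk_surjective (I := relIdeal R t S) a
  induction p using MvPolynomial.induction_on with
  | C r =>
    have := h₁ r
    rw [← Algebra.algebraMap_eq_smul_one] at this
    exact this
  | add p q hp hq => rw [map_add]; exact U.add_mem hp hq
  | mul_X p s hp => rw [map_mul]; exact h₂ _ hp s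

lemma tensorPower_hom_ext {B : Type*} [Semiring B] {f g : TensorPower R t S →+* B}
    (h₁ : ∀ r : R, f (r • 1) = g (r • 1)) (h₂ : ∀ s, f (gen R t s) = g (gen R t s)) : f = g := by
  refine Ideal.Quotient.ringHom_ext (MvPolynomial.ringHom_ext (fun r => ?_) h₂)
  have := h₁ r
  rw [← Algebra.algebraMap_eq_smul_one] at this
  exact this

lemma span_monomial : Submodule.span R (Set.range (monomial R t : Finset S → _)) = ⊤ := by
  classical
  rw [eq_top_iff]
  intro a _
  refine tensorPower_induction
    (U := (Submodule.span R (Set.range (monomial R t : Finset S → _))).toAddSubgroup) ?_ ?_ a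
  · intro r
    exact Submodule.smul_mem _ _ (Submodule.subset_span ⟨∅, by simp [monomial]⟩)
  · intro a ha s
    rw [Submodule.mem_toAddSubgroup] at ha ⊢
    induction ha using Submodule.span_induction with
    | mem _ h =>
      obtain ⟨T, rfl⟩ := h
      by_cases hs : s ∈ T
      · rw [monomial_mul_gen_of_mem hs]
        exact Submodule.smul_mem _ _ (Submodule.subset_span ⟨_, rfl⟩)
      · rw [monomial_mul_gen_of_notMem hs]
        exact Submodule.subset_span ⟨_, rfl⟩
    | zero => rw [zero_mul]; exact Submodule.zero_mem _
    | add _ _ _ _ h₁ h₂ => rw [add_mul]; exact Submodule.add_mem _ h₁ h₂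
    | smul r _ _ h => rw [smul_mul_assoc]; exact Submodule.smul_mem _ _ h

/-- An extension `K` of `R` in which `t` has a nonzero square root. -/
structure RootExtension (R : Type) [CommRing R] (t : R) (K : Type) [CommRing K] where
  toHom : R →+* K
  injective : Function.Injective toHom
  root : K
  root_sq : root ^ 2 = toHom t
  root_ne_zero : root ≠ 0

variable {K : Type} [CommRing K]

/-- The character of the tensor power `A^{⊗ S}` which maps the generator `X` in the factor of
index `s` to the square root of `t` of sign `ε s`. -/
def RootExtension.eval (A : RootExtension R t K) (ε : S → ℤˣ) : TensorPower R t S →+* K :=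
  Ideal.Quotient.lift (relIdeal R t S)
    (MvPolynomial.eval₂Hom A.toHom fun s => ((ε s : ℤ) : K) * A.root) (by
    intro a ha
    rw [← RingHom.mem_ker]
    refine (Ideal.span_le.2 ?_ : relIdeal R t S ≤ RingHom.ker _) ha
    rintro _ ⟨s, rfl⟩
    have h : ((ε s : ℤ) : K) ^ 2 = 1 := by
      rw [← Int.cast_pow, ← Units.val_pow_eq_pow_val, Int.units_sq]; simp
    simp [RingHom.mem_ker, mul_pow, A.root_sq, h])

namespace RootExtension

variable (A : RootExtension R t K)

@[simp] lemma eval_gen (ε : S → ℤˣ) (s : S) :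
    A.eval ε (gen R t s) = ((ε s : ℤ) : K) * A.root := by
  change MvPolynomial.eval₂Hom _ _ (MvPolynomial.X s) = _
  simp

@[simp] lemma eval_smul (ε : S → ℤˣ) (r : R) (a : TensorPower R t S) :
    A.eval ε (r • a) = A.toHom r * A.eval ε a := by
  rw [Algebra.smul_def, map_mul]
  congr 1
  change MvPolynomial.eval₂Hom _ _ (MvPolynomial.C r) = _
  simp

lemma eval_monomial (ε : S → ℤˣ) (T : Finset S) :
    A.eval ε (monomial R t T) = (∏ s ∈ T, ((ε s : ℤ) : K)) * A.root ^ T.card := by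
  simp [monomial, map_prod, Finset.prod_mul_distrib]

lemma eval_tensorMap {S' : Type} (f : S → S') (ε : S' → ℤˣ) (a : TensorPower R t S) :
    A.eval ε (tensorMap R t f a) = A.eval (fun s => ε (f s)) a := by
  have : (A.eval ε).comp (tensorMap R t f : TensorPower R t S →+* TensorPower R t S') =
      A.eval fun s => ε (f s) := by
    refine tensorPower_hom_ext (fun r => ?_) fun s => ?_
    · simp
    · simp [tensorMap_gen]
  exact RingHom.congr_fun this a

/-- Orthogonality of the characters of the group `{±1} ^ S`. -/
lemma sum_prod_mul_prod [Fintype S] [DecidableEq S] (T T' : Finset S) :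
    ∑ ε : S → ℤˣ, (∏ s ∈ T, ((ε s : ℤ) : K)) * ∏ s ∈ T', ((ε s : ℤ) : K) =
      if T' = T then 2 ^ Fintype.card S else 0 := by
  have h1 : ∀ ε : S → ℤˣ, (∏ s ∈ T, ((ε s : ℤ) : K)) * ∏ s ∈ T', ((ε s : ℤ) : K) =
      ∏ s, (if s ∈ T then ((ε s : ℤ) : K) else 1) * (if s ∈ T' then ((ε s : ℤ) : K) else 1) := by
    intro ε
    rw [Finset.prod_mul_distrib, Finset.prod_ite_mem, Finset.prod_ite_mem, Finset.univ_inter,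
      Finset.univ_inter]
  simp only [h1]
  have h2 := Finset.prod_univ_sum (fun _ : S => (Finset.univ : Finset ℤˣ))
    (fun s u => (if s ∈ T then ((u : ℤ) : K) else 1) * (if s ∈ T' then ((u : ℤ) : K) else 1))
  rw [Fintype.piFinset_univ] at h2
  rw [← h2]
  have h3 : ∀ s, (∑ u : ℤˣ, (if s ∈ T then ((u : ℤ) : K) else 1) *
      (if s ∈ T' then ((u : ℤ) : K) else 1)) = if (s ∈ T' ↔ s ∈ T) then 2 else 0 := by
    intro s
    rw [show (Finset.univ : Finset ℤˣ) = {1, -1} from rfl, Finset.sum_pair (by decide)]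
    by_cases h : s ∈ T <;> by_cases h' : s ∈ T' <;> simp [h, h'] <;> norm_num
  simp only [h3]
  split_ifs with hT
  · subst hT
    simp
  · obtain ⟨s, hs⟩ : ∃ s, ¬ (s ∈ T' ↔ s ∈ T) := by
      by_contra h
      push Not at h
      exact hT (Finset.ext h)
    exact Finset.prod_eq_zero (Finset.mem_univ s) (if_neg hs)

/-- The characters separate the points of a tensor power. -/
lemma eq_zero_of_eval [IsDomain K] [CharZero K] [Finite S] {a : TensorPower R t S}
    (h : ∀ ε : S → ℤˣ, A.eval ε a = 0) : a = 0 := by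
  classical
  have := Fintype.ofFinite S
  have ha : a ∈ Submodule.span R (Set.range (monomial R t : Finset S → _)) := by
    rw [span_monomial]; trivial
  obtain ⟨c, rfl⟩ := (Submodule.mem_span_range_iff_exists_fun R).1 ha
  have hc : ∀ T, c T = 0 := by
    intro T
    have h0 : ∑ ε : S → ℤˣ, (∏ s ∈ T, ((ε s : ℤ) : K)) *
        A.eval ε (∑ T', c T' • monomial R t T') = 0 :=
      Finset.sum_eq_zero fun ε _ => by rw [h ε, mul_zero]
    have h1 : ∀ ε : S → ℤˣ, (∏ s ∈ T, ((ε s : ℤ) : K)) *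
        A.eval ε (∑ T', c T' • monomial R t T') = ∑ T', (A.toHom (c T') * A.root ^ T'.card) *
          ((∏ s ∈ T, ((ε s : ℤ) : K)) * ∏ s ∈ T', ((ε s : ℤ) : K)) := by
      intro ε
      rw [map_sum, Finset.mul_sum]
      refine Finset.sum_congr rfl fun T' _ => ?_
      rw [eval_smul, eval_monomial]
      ring
    simp only [h1] at h0
    rw [Finset.sum_comm] at h0
    simp only [← Finset.mul_sum, sum_prod_mul_prod, mul_ite, mul_zero, Finset.sum_ite_eq',
      Finset.mem_univ, if_true] at h0
    have h2 : (2 : K) ^ Fintype.card S ≠ 0 := pow_ne_zero _ two_ne_zero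
    have h3 := pow_ne_zero T.card A.root_ne_zero
    have h4 : A.toHom (c T) = 0 := by
      rcases mul_eq_zero.1 h0 with h | h
      · rcases mul_eq_zero.1 h with h | h
        · exact h
        · exact absurd h h3
      · exact absurd h h2
    exact A.injective (by rw [h4, map_zero])
  simp [hc]

end RootExtension

end TensorPower

/-! ### Edge maps in terms of edge colourings -/

variable {D : GaussCode}

lemma circle_firstEdge {v : D.Vertex} (s : D.Circle v) : D.circle v (D.firstEdge s) = s :=
  (D.mem_edgesOf s _).1 (Finset.min'_mem _ _)

/-- A colouring of the edges with `±1` which is constant on the circles of the resolution `v`. -/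
def IsColouring (v : D.Vertex) (ε : D.Edge → ℤˣ) : Prop := ∀ a b, D.Joined v a b → ε a = ε b

lemma IsColouring.eq {v : D.Vertex} {ε : D.Edge → ℤˣ} (h : IsColouring v ε) {a b : D.Edge}
    (hab : D.circle v a = D.circle v b) : ε a = ε b :=
  congrArg (Quot.lift ε h) hab

lemma IsColouring.firstEdge {v : D.Vertex} {ε : D.Edge → ℤˣ} (h : IsColouring v ε) (a : D.Edge) :
    ε (D.firstEdge (D.circle v a)) = ε a :=
  h.eq (circle_firstEdge _)

lemma isColouring_iff {v : D.Vertex} {ε : D.Edge → ℤˣ} :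
    IsColouring v ε ↔ ε (Fin.last _) = ε 0 ∧ ∀ c,
      (D.positive c ≠ v c → ε (D.underIn c) = ε (D.overOut c) ∧ ε (D.overIn c) = ε (D.underOut c)) ∧
      (D.positive c = v c → ε (D.underIn c) = ε (D.overIn c) ∧
        ε (D.underOut c) = ε (D.overOut c)) := by
  constructor
  · intro h
    exact ⟨h _ _ .base, fun c => ⟨fun hc => ⟨h _ _ (.oriented₁ c hc), h _ _ (.oriented₂ c hc)⟩,
      fun hc => ⟨h _ _ (.unoriented₁ c hc), h _ _ (.unoriented₂ c hc)⟩⟩⟩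
  · rintro ⟨h0, h⟩ a b hab
    cases hab with
    | base => exact h0
    | oriented₁ c hc => exact ((h c).1 hc).1
    | oriented₂ c hc => exact ((h c).1 hc).2
    | unoriented₁ c hc => exact ((h c).2 hc).1
    | unoriented₂ c hc => exact ((h c).2 hc).2

/-- A colouring stays one under a change of smoothing at a crossing where all colours agree. -/
lemma IsColouring.of_adj {v w : D.Vertex} {c : Fin D.n} {ε : D.Edge → ℤˣ} (hw : IsColouring w ε)
    (h : Adj v w c) (hc : ε (D.underIn c) = ε (D.underOut c)) : IsColouring v ε := by
  rw [isColouring_iff] at hw ⊢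
  refine ⟨hw.1, fun c' => ?_⟩
  rcases eq_or_ne c' c with rfl | hne
  · have := hw.2 c'
    grind
  · rw [← h.2 c' hne]
    exact hw.2 c'

lemma IsColouring.underIn_eq {v w : D.Vertex} {c : Fin D.n} {ε : D.Edge → ℤˣ}
    (hv : IsColouring v ε) (hw : IsColouring w ε) (h : Adj v w c) :
    ε (D.underIn c) = ε (D.underOut c) ∧ ε (D.overIn c) = ε (D.underIn c) ∧
      ε (D.overOut c) = ε (D.underIn c) := by
  have h1 := (isColouring_iff.1 hv).2 c
  have h2 := (isColouring_iff.1 hw).2 c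
  rw [h.1] at h2
  by_cases hc : D.positive c = v c
  · have h3 := h1.2 hc
    have h4 := h2.1 (by rw [hc]; simp)
    grind
  · have h3 := h1.1 hc
    have h4 := h2.2 (by revert hc; cases D.positive c <;> cases v c <;> simp)
    grind

/-- Whether two edges are on the same circle does not depend on the smoothing at a crossing with
edges of the other colour. -/
lemma IsColouring.circle_eq_of_adj {v w : D.Vertex} {c : Fin D.n} {ε : D.Edge → ℤˣ}
    (hv : IsColouring v ε) (hw : IsColouring w ε) (h : Adj v w c) {a b : D.Edge}
    (ha : ε a ≠ ε (D.underIn c)) (hab : D.circle v a = D.circle v b) :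
    D.circle w a = D.circle w b := by
  classical
  obtain ⟨e1, e2, e3⟩ := hv.underIn_eq hw h
  let F : D.Edge → Option (D.Circle w) := fun e =>
    if ε e = ε (D.underIn c) then none else some (D.circle w e)
  have hF : ∀ a b, D.Joined v a b → F a = F b := by
    intro a b hj
    have hε := hv a b hj
    simp only [F, hε]
    split_ifs with hb
    · rfl
    congr 1
    cases hj with
    | base => exact circle_base w
    | oriented₁ c' hc =>
      rcases eq_or_ne c' c with rfl | hne
      · exact absurd e3 hb
      · exact (circle_oriented (by rwa [h.2 c' hne])).1
    | oriented₂ c' hc =>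
      rcases eq_or_ne c' c with rfl | hne
      · exact absurd e1.symm hb
      · exact (circle_oriented (by rwa [h.2 c' hne])).2
    | unoriented₁ c' hc =>
      rcases eq_or_ne c' c with rfl | hne
      · exact absurd e2 hb
      · exact (circle_unoriented (by rwa [h.2 c' hne])).1
    | unoriented₂ c' hc =>
      rcases eq_or_ne c' c with rfl | hne
      · exact absurd e3 hb
      · exact (circle_unoriented (by rwa [h.2 c' hne])).2
  have := congrArg (Quot.lift F hF) hab
  change F a = F b at this
  simp only [F, if_neg ha, ← hv.eq hab] at this
  exact Option.some.inj this

variable {R : Type} [CommRing R] {t : R} {K : Type} [CommRing K]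

namespace RootExtension

variable (A : RootExtension R t K)

/-- The character of the module at a vertex given by a colouring of the edges. -/
def edgeEval (v : D.Vertex) (ε : D.Edge → ℤˣ) : D.VertexModule R t v →+* K :=
  A.eval fun s => ε (D.firstEdge s)

lemma edgeEval_smul (v : D.Vertex) (ε : D.Edge → ℤˣ) (r : R) (a : D.VertexModule R t v) :
    A.edgeEval v ε (r • a) = A.toHom r * A.edgeEval v ε a :=
  A.eval_smul _ _ _

lemma edgeEval_gen {v : D.Vertex} {ε : D.Edge → ℤˣ} (h : IsColouring v ε) (e : D.Edge) :
    A.edgeEval v ε (gen R t (D.circle v e)) = ((ε e : ℤ) : K) * A.root := by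
  rw [edgeEval, eval_gen, h.firstEdge]

lemma edgeEval_ext [IsDomain K] [CharZero K] {v : D.Vertex} {a b : D.VertexModule R t v}
    (h : ∀ ε, IsColouring v ε → A.edgeEval v ε a = A.edgeEval v ε b) : a = b := by
  rw [← sub_eq_zero]
  refine A.eq_zero_of_eval fun η => ?_
  have := h (fun e => η (D.circle v e)) fun a b hab => congrArg η (Quot.sound hab)
  simp only [edgeEval, circle_firstEdge] at this
  rw [map_sub, this, sub_self]

open Classical in
/-- The factor by which an edge map leaving `v` at `c` acts on the part of colour `ε`. -/
def edgeScalar (v : D.Vertex) (c : Fin D.n) (ε : D.Edge → ℤˣ) : K :=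
  if D.circle v (D.underIn c) = D.circle v (D.underOut c) then
    (((ε (D.underIn c) : ℤ) : K) + ((ε (D.underOut c) : ℤ) : K)) * A.root else 1

lemma edgeEval_edgeMap {v w : D.Vertex} {c : Fin D.n} {ε : D.Edge → ℤˣ} (hw : IsColouring w ε)
    (a : D.VertexModule R t v) :
    A.edgeEval w ε (D.edgeMap R t v w c a) = A.edgeScalar v c ε * A.edgeEval v ε a := by
  simp only [edgeMap, LinearMap.comp_apply, AlgHom.toLinearMap_apply, LinearMap.mulRight_apply,
    map_mul]
  rw [mul_comm]
  congr 1
  · simp only [edgeFactor, edgeScalar]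
    split_ifs
    · rw [map_add, edgeEval_gen _ hw, edgeEval_gen _ hw, add_mul]
    · exact map_one _
  · rw [edgeEval, eval_tensorMap, edgeEval]
    simp only [hw.firstEdge]

lemma edgeScalar_eq_zero (hD : D.IsEven) {v w : D.Vertex} {c : Fin D.n} {ε : D.Edge → ℤˣ}
    (hw : IsColouring w ε) (h : Adj v w c) (hc : ε (D.underIn c) ≠ ε (D.underOut c)) :
    A.edgeScalar v c ε = 0 := by
  have h1 : D.circle v (D.underIn c) = D.circle v (D.underOut c) := by
    by_contra hv
    exact hc (hw.eq ((h.circle_iff hD).2 hv))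
  rw [edgeScalar, if_pos h1, Int.units_ne_iff_eq_neg.1 hc]
  simp

lemma edgeScalar_mul_reverse (hD : D.IsEven) {v w : D.Vertex} {c : Fin D.n} (h : Adj v w c)
    (ε : D.Edge → ℤˣ) : A.edgeScalar v c ε * A.edgeScalar w c ε =
      (((ε (D.underIn c) : ℤ) : K) + ((ε (D.underOut c) : ℤ) : K)) * A.root := by
  have := h.circle_iff hD
  simp only [edgeScalar]
  split_ifs with h1 h2 h2
  · exact absurd h1 (this.1 h2)
  · rw [mul_one]
  · rw [one_mul]
  · exact absurd (this.2 h1) h2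

/-- For a colouring of all four resolutions the square of edge maps commutes.  If the two crossings
have the same colour, the numbers of splits along the two paths agree since the numbers of circles
at the ends do; otherwise the change at one crossing does not affect the circles at the other. -/
lemma edgeScalar_comm (hD : D.IsEven) {v v₁ v₂ w : D.Vertex} {c c' : Fin D.n}
    (h₁ : Adj v v₁ c) (h₂ : Adj v v₂ c') (h₁' : Adj v₁ w c') (h₂' : Adj v₂ w c)
    {ε : D.Edge → ℤˣ} (hw : IsColouring w ε) (hc : ε (D.underIn c) = ε (D.underOut c))
    (hc' : ε (D.underIn c') = ε (D.underOut c')) :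
    A.edgeScalar v₁ c' ε * A.edgeScalar v c ε = A.edgeScalar v₂ c ε * A.edgeScalar v c' ε := by
  have hv₁ := hw.of_adj h₁' hc'
  have hv₂ := hw.of_adj h₂' hc
  have hv := hv₁.of_adj h₁ hc
  by_cases hcc : ε (D.underIn c) = ε (D.underIn c')
  · have m1 := h₁.numCircles_merge hD
    have s1 := h₁.numCircles_split hD
    have m2 := h₂.numCircles_merge hD
    have s2 := h₂.numCircles_split hD
    have m1' := h₁'.numCircles_merge hD
    have s1' := h₁'.numCircles_split hD
    have m2' := h₂'.numCircles_merge hD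
    have s2' := h₂'.numCircles_split hD
    simp only [edgeScalar, ← hc, ← hc', ← hcc]
    by_cases a1 : D.circle v (D.underIn c) = D.circle v (D.underOut c) <;>
    by_cases a2 : D.circle v (D.underIn c') = D.circle v (D.underOut c') <;>
    by_cases a3 : D.circle v₁ (D.underIn c') = D.circle v₁ (D.underOut c') <;>
    by_cases a4 : D.circle v₂ (D.underIn c) = D.circle v₂ (D.underOut c) <;>
    simp only [a1, a2, a3, a4, not_true, not_false_eq_true, forall_const, false_imp_iff, if_true,
      if_false] at m1 s1 m2 s2 m1' s1' m2' s2' ⊢ <;>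
    first | omega | ring
  · have e1 : D.circle v (D.underIn c') = D.circle v (D.underOut c') ↔
        D.circle v₁ (D.underIn c') = D.circle v₁ (D.underOut c') :=
      ⟨hv.circle_eq_of_adj hv₁ h₁ (Ne.symm hcc), hv₁.circle_eq_of_adj hv h₁.symm (Ne.symm hcc)⟩
    have e2 : D.circle v (D.underIn c) = D.circle v (D.underOut c) ↔
        D.circle v₂ (D.underIn c) = D.circle v₂ (D.underOut c) :=
      ⟨hv.circle_eq_of_adj hv₂ h₂ hcc, hv₂.circle_eq_of_adj hv h₂.symm hcc⟩
    have f1 : A.edgeScalar v c' ε = A.edgeScalar v₁ c' ε := by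
      classical exact if_congr e1 rfl rfl
    have f2 : A.edgeScalar v c ε = A.edgeScalar v₂ c ε := by
      classical exact if_congr e2 rfl rfl
    rw [f1, f2, mul_comm]

/-- If the colours at `c'` differ, the part of colour `ε` is lost on the path on which the smoothing at
`c'` is changed first. -/
lemma edgeScalar_mul_eq_zero (hD : D.IsEven) {v v₂ w : D.Vertex} {c c' : Fin D.n}
    (h₂ : Adj v v₂ c') (h₂' : Adj v₂ w c)
    {ε : D.Edge → ℤˣ} (hw : IsColouring w ε) (hc' : ε (D.underIn c') ≠ ε (D.underOut c')) :
    A.edgeScalar v₂ c ε * A.edgeScalar v c' ε = 0 := by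
  by_cases hc : ε (D.underIn c) = ε (D.underOut c)
  · rw [A.edgeScalar_eq_zero hD (hw.of_adj h₂' hc) h₂ hc', mul_zero]
  · rw [A.edgeScalar_eq_zero hD hw h₂' hc, zero_mul]

lemma edgeEval_edgeMap_edgeMap (hD : D.IsEven) {v v₁ w : D.Vertex} {c c' : Fin D.n}
    (h₁' : Adj v₁ w c') {ε : D.Edge → ℤˣ} (hw : IsColouring w ε) (a : D.VertexModule R t v) :
    A.edgeEval w ε (D.edgeMap R t v₁ w c' (D.edgeMap R t v v₁ c a)) =
      A.edgeScalar v₁ c' ε * A.edgeScalar v c ε * A.edgeEval v ε a := by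
  rw [A.edgeEval_edgeMap hw]
  by_cases hc' : ε (D.underIn c') = ε (D.underOut c')
  · rw [A.edgeEval_edgeMap (hw.of_adj h₁' hc'), mul_assoc]
  · rw [A.edgeScalar_eq_zero hD hw h₁' hc', zero_mul, zero_mul, zero_mul]

variable [IsDomain K] [CharZero K]
include A

/-- Changes of smoothings at different crossings commute, in whatever direction they go. -/
lemma edgeMap_comm (hD : D.IsEven) {v v₁ v₂ w : D.Vertex} {c c' : Fin D.n}
    (h₁ : Adj v v₁ c) (h₂ : Adj v v₂ c') (h₁' : Adj v₁ w c') (h₂' : Adj v₂ w c)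
    (a : D.VertexModule R t v) :
    D.edgeMap R t v₁ w c' (D.edgeMap R t v v₁ c a) =
      D.edgeMap R t v₂ w c (D.edgeMap R t v v₂ c' a) := by
  refine A.edgeEval_ext fun ε hw => ?_
  rw [A.edgeEval_edgeMap_edgeMap hD h₁' hw, A.edgeEval_edgeMap_edgeMap hD h₂' hw]
  congr 1
  by_cases hc : ε (D.underIn c) = ε (D.underOut c)
  · by_cases hc' : ε (D.underIn c') = ε (D.underOut c')
    · exact A.edgeScalar_comm hD h₁ h₂ h₁' h₂' hw hc hc'
    · rw [A.edgeScalar_mul_eq_zero hD h₂ h₂' hw hc', A.edgeScalar_eq_zero hD hw h₁' hc', zero_mul]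
  · rw [A.edgeScalar_mul_eq_zero hD h₁ h₁' hw hc, A.edgeScalar_eq_zero hD hw h₂' hc, zero_mul]

/-- An edge map followed by the one in the opposite direction. -/
lemma edgeMap_reverse (hD : D.IsEven) {v w : D.Vertex} {c : Fin D.n} (h : Adj v w c)
    (a : D.VertexModule R t v) :
    D.edgeMap R t w v c (D.edgeMap R t v w c a) =
      a * (gen R t (D.circle v (D.underIn c)) + gen R t (D.circle v (D.underOut c))) := by
  refine A.edgeEval_ext fun ε hv => ?_
  rw [A.edgeEval_edgeMap_edgeMap hD h.symm hv, mul_comm (A.edgeScalar w c ε),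
    A.edgeScalar_mul_reverse hD h, map_mul, map_add, A.edgeEval_gen hv, A.edgeEval_gen hv]
  ring

/-- Edge maps commute with multiplication by `X` on the circle through any edge. -/
lemma edgeMap_mul_gen_circle (hD : D.IsEven) {v w : D.Vertex} {c : Fin D.n} (h : Adj v w c)
    (a : D.VertexModule R t v) (e : D.Edge) :
    D.edgeMap R t v w c (a * gen R t (D.circle v e)) =
      D.edgeMap R t v w c a * gen R t (D.circle w e) := by
  refine A.edgeEval_ext fun ε hw => ?_
  rw [A.edgeEval_edgeMap hw, map_mul, map_mul, A.edgeEval_edgeMap hw]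
  by_cases hc : ε (D.underIn c) = ε (D.underOut c)
  · rw [A.edgeEval_gen hw, A.edgeEval_gen (hw.of_adj h hc), mul_assoc]
  · rw [A.edgeScalar_eq_zero hD hw h hc, zero_mul, zero_mul, zero_mul]

end RootExtension

end GaussCode

/-! ### The homotopies at the crossings -/

namespace GaussCode

variable {D : GaussCode} {R : Type} [CommRing R] {t : R} {K : Type} [CommRing K]

lemma differential_apply (z : D.Chain R t) (w : D.Vertex) :
    D.differential R t z w = ∑ c ∈ Finset.univ.filter (fun c => w c = true),
      ((-1 : ℤ) ^ D.precede w c) • D.edgeMap R t (Function.update w c false) w c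
        (z (Function.update w c false)) := by
  simp [differential, LinearMap.sum_apply]

lemma precede_update_self (v : D.Vertex) (c : Fin D.n) (b : Bool) :
    D.precede (Function.update v c b) c = D.precede v c := by
  unfold precede
  congr 1
  ext c'
  simp only [Finset.mem_filter, Finset.mem_univ, true_and, and_congr_right_iff]
  intro h
  rw [Function.update_of_ne h.ne]

lemma precede_update_of_lt (v : D.Vertex) {c c' : Fin D.n} (b : Bool) (h : c < c') :
    D.precede (Function.update v c' b) c = D.precede v c := by
  unfold precede
  congr 1
  ext c''
  simp only [Finset.mem_filter, Finset.mem_univ, true_and, and_congr_right_iff]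
  intro h'
  rw [Function.update_of_ne (h'.trans h).ne]

lemma precede_update_true_of_gt {v : D.Vertex} {c c' : Fin D.n} (h : c' < c) (hv : v c' = false) :
    D.precede (Function.update v c' true) c = D.precede v c + 1 := by
  have : (Finset.univ.filter fun a => a < c ∧ Function.update v c' true a = true) =
      insert c' (Finset.univ.filter fun a => a < c ∧ v a = true) := by
    ext a
    rcases eq_or_ne a c' with rfl | hc <;> simp [*]
  rw [precede, this, Finset.card_insert_of_notMem (by simp [hv]), precede]

lemma precede_update_false_of_gt {v : D.Vertex} {c c' : Fin D.n} (h : c' < c) (hv : v c' = true) :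
    D.precede (Function.update v c' false) c + 1 = D.precede v c := by
  rw [← precede_update_true_of_gt h (by simp), Function.update_idem, ← hv,
    Function.update_eq_self]

lemma adj_update_true {v : D.Vertex} {c : Fin D.n} (h : v c = false) :
    Adj v (Function.update v c true) c := by
  have := adj_update v c
  rwa [h] at this

lemma adj_update_false {v : D.Vertex} {c : Fin D.n} (h : v c = true) :
    Adj v (Function.update v c false) c := by
  have := adj_update v c
  rwa [h] at this

/-- The sum of the signed reverse edge maps at the crossing `c`. -/
def homotopy (c : Fin D.n) : D.Chain R t →ₗ[R] D.Chain R t :=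
  LinearMap.pi fun v => if v c = false then ((-1 : ℤ) ^ D.precede v c) •
    (D.edgeMap R t (Function.update v c true) v c ∘ₗ LinearMap.proj (Function.update v c true))
    else 0

lemma homotopy_apply_of_false {c : Fin D.n} (z : D.Chain R t) {v : D.Vertex} (h : v c = false) :
    homotopy c z v = ((-1 : ℤ) ^ D.precede v c) • D.edgeMap R t (Function.update v c true) v c
      (z (Function.update v c true)) := by
  simp only [homotopy, LinearMap.pi_apply, if_pos h]
  simp

lemma homotopy_apply_of_true {c : Fin D.n} (z : D.Chain R t) {v : D.Vertex} (h : v c = true) :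
    homotopy c z v = 0 := by
  simp [homotopy, h]

/-- The action of `X` on the circles through the edge `e`. -/
def edgeChain (e : D.Edge) : D.Chain R t →ₗ[R] D.Chain R t :=
  LinearMap.pi fun v => LinearMap.mulRight R (gen R t (D.circle v e)) ∘ₗ LinearMap.proj v

lemma edgeChain_apply (e : D.Edge) (z : D.Chain R t) (v : D.Vertex) :
    edgeChain e z v = z v * gen R t (D.circle v e) := rfl

lemma edgeChain_edgeChain (e : D.Edge) (z : D.Chain R t) : edgeChain e (edgeChain e z) = t • z := by
  funext v
  rw [edgeChain_apply, edgeChain_apply, mul_assoc, gen_mul_self, mul_smul_comm, mul_one]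
  rfl

/-- Either smoothing joins the two edges of one strand to the two edges of the other. -/
lemma gen_over_add_gen_over (v : D.Vertex) (c : Fin D.n) :
    gen R t (D.circle v (D.overIn c)) + gen R t (D.circle v (D.overOut c)) =
      gen R t (D.circle v (D.underIn c)) + gen R t (D.circle v (D.underOut c)) := by
  by_cases h : D.positive c = v c
  · rw [(circle_unoriented h).1, (circle_unoriented h).2]
  · rw [(circle_oriented h).1, (circle_oriented h).2, add_comm]

namespace RootExtension

variable [IsDomain K] [CharZero K] (A : RootExtension R t K)
include A

lemma differential_edgeChain (hD : D.IsEven) (e : D.Edge) (z : D.Chain R t) :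
    D.differential R t (edgeChain e z) = edgeChain e (D.differential R t z) := by
  funext w
  rw [edgeChain_apply, differential_apply, differential_apply, Finset.sum_mul]
  refine Finset.sum_congr rfl fun c hc => ?_
  rw [Finset.mem_filter] at hc
  rw [edgeChain_apply, A.edgeMap_mul_gen_circle hD (adj_update_false hc.2).symm, smul_mul_assoc]

/-- The signs are arranged so that the off-diagonal terms cancel. -/
lemma homotopy_cancel (hD : D.IsEven) {u : D.Vertex} {c c' : Fin D.n} (hc : u c = false)
    (hc' : u c' = true) (z : D.Chain R t) :
    ((-1 : ℤ) ^ D.precede u c') • D.edgeMap R t (Function.update u c' false) u c'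
      (homotopy c z (Function.update u c' false)) +
    ((-1 : ℤ) ^ D.precede u c) • D.edgeMap R t (Function.update u c true) u c
      (((-1 : ℤ) ^ D.precede (Function.update u c true) c') •
        D.edgeMap R t (Function.update (Function.update u c true) c' false)
          (Function.update u c true) c'
          (z (Function.update (Function.update u c true) c' false))) = 0 := by
  have hne : c' ≠ c := by
    rintro rfl
    rw [hc] at hc'
    exact Bool.false_ne_true hc'
  have h1 : Function.update u c' false c = false := by rw [Function.update_of_ne hne.symm, hc]
  have h2 : Function.update u c true c' = true := by rw [Function.update_of_ne hne, hc']
  rw [homotopy_apply_of_false z h1, map_zsmul, map_zsmul]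
  have hx : Function.update (Function.update u c' false) c true =
      Function.update (Function.update u c true) c' false := Function.update_comm hne _ _ _
  have a1 := adj_update_true h1
  have a2 := adj_update_false h2
  rw [hx] at a1 ⊢
  rw [A.edgeMap_comm hD a1.symm a2.symm (adj_update_false hc').symm (adj_update_true hc).symm,
    smul_smul, smul_smul, ← add_smul]
  have hsign : (-1 : ℤ) ^ D.precede u c' * (-1) ^ D.precede (Function.update u c' false) c +
      (-1 : ℤ) ^ D.precede u c * (-1) ^ D.precede (Function.update u c true) c' = 0 := by
    rcases lt_or_gt_of_ne hne with h | h
    · rw [precede_update_of_lt _ _ h, ← precede_update_false_of_gt h hc']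
      ring
    · rw [precede_update_of_lt _ _ h, precede_update_true_of_gt h hc]
      ring
  rw [hsign, zero_smul]

/-- The sum of the actions of `X` on both sides of a passage is null-homotopic. -/
lemma differential_homotopy_add (hD : D.IsEven) (c : Fin D.n) (z : D.Chain R t) :
    D.differential R t (homotopy c z) + homotopy c (D.differential R t z) =
      edgeChain (D.underIn c) z + edgeChain (D.underOut c) z := by
  funext u
  have sq : ∀ k : ℕ, (-1 : ℤ) ^ k * (-1) ^ k = 1 := fun k => by
    rw [← mul_pow]; simp
  simp only [Pi.add_apply, edgeChain_apply, ← mul_add]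
  cases hc : u c
  · rw [homotopy_apply_of_false _ hc, differential_apply, differential_apply]
    have hfil : (Finset.univ.filter fun c' => Function.update u c true c' = true) =
        insert c (Finset.univ.filter fun c' => u c' = true) := by
      ext c'
      rcases eq_or_ne c' c with rfl | hc <;> simp [*]
    have hu : Function.update (Function.update u c true) c false = u := by
      rw [Function.update_idem, ← hc, Function.update_eq_self]
    rw [hfil, Finset.sum_insert (by simp [hc]), map_add, smul_add, map_sum, Finset.smul_sum,
      add_left_comm, ← Finset.sum_add_distrib, Finset.sum_eq_zero, add_zero]
    · rw [hu, map_zsmul, smul_smul, precede_update_self, sq, one_smul,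
        A.edgeMap_reverse hD (adj_update_true hc)]
    · intro c' hc'
      rw [Finset.mem_filter] at hc'
      exact A.homotopy_cancel hD hc hc'.2 z
  · rw [homotopy_apply_of_true _ hc, add_zero, differential_apply,
      Finset.sum_eq_single_of_mem c (by simp [hc])]
    · have hu : Function.update (Function.update u c false) c true = u := by
        rw [Function.update_idem, ← hc, Function.update_eq_self]
      rw [homotopy_apply_of_false _ (by simp), hu, map_zsmul, smul_smul, precede_update_self, sq,
        one_smul, A.edgeMap_reverse hD (adj_update_false hc)]
    · intro c' _ hne
      rw [homotopy_apply_of_true _ (by rw [Function.update_of_ne hne.symm, hc]), map_zero,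
        smul_zero]

lemma edgeChain_passage_mem_range (hD : D.IsEven) {z : D.Chain R t}
    (hz : D.differential R t z = 0) (k : Fin (2 * D.n)) :
    edgeChain k.castSucc z + edgeChain k.succ z ∈ LinearMap.range (D.differential R t) := by
  have h : ∀ c : Fin D.n, edgeChain (D.underIn c) z + edgeChain (D.underOut c) z ∈
      LinearMap.range (D.differential R t) := fun c =>
    ⟨homotopy c z, by rw [← A.differential_homotopy_add hD c z, hz, map_zero, add_zero]⟩
  refine passage_cases (motive := fun a b => edgeChain a z + edgeChain b z ∈
    LinearMap.range (D.differential R t)) h (fun c => ?_) k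
  have : edgeChain (D.overIn c) z + edgeChain (D.overOut c) z =
      edgeChain (D.underIn c) z + edgeChain (D.underOut c) z := by
    funext v
    simp only [Pi.add_apply, edgeChain_apply, ← mul_add, gen_over_add_gen_over]
  rw [this]
  exact h c

/-- Up to boundaries, `X` acts on a cycle at all edges in the same way, with alternating signs. -/
lemma edgeChain_sub_mem_range (hD : D.IsEven) {z : D.Chain R t}
    (hz : D.differential R t z = 0) (e : D.Edge) :
    edgeChain e z - ((-1 : ℤ) ^ (e : ℕ)) • edgeChain 0 z ∈
      LinearMap.range (D.differential R t) := by
  induction e using Fin.induction with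
  | zero => simp
  | succ k ih =>
    have h := A.edgeChain_passage_mem_range hD hz k
    have h2 : edgeChain k.succ z - ((-1 : ℤ) ^ (k.succ : ℕ)) • edgeChain 0 z =
        (edgeChain k.castSucc z + edgeChain k.succ z) -
          (edgeChain k.castSucc z - ((-1 : ℤ) ^ (k.castSucc : ℕ)) • edgeChain 0 z) := by
      rw [Fin.val_succ, Fin.val_castSucc, pow_succ, mul_neg_one, neg_smul]
      abel
    rw [h2]
    exact Submodule.sub_mem _ h ih

end RootExtension

/-! ### Cycles at the oriented resolution -/

/-- The alternating colouring of the edges. -/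
def alternating (D : GaussCode) : D.Edge → ℤˣ := fun e => (-1) ^ (e : ℕ)

lemma alternating_zero : D.alternating 0 = 1 := by simp [alternating]

lemma alternating_passage (c : Fin D.n) :
    D.alternating (D.underOut c) = -D.alternating (D.underIn c) ∧
    D.alternating (D.overOut c) = -D.alternating (D.overIn c) := by
  simp [alternating, underIn_val, underOut_val, overIn_val, overOut_val, pow_succ]

lemma alternating_overIn (hD : D.IsEven) (c : Fin D.n) :
    D.alternating (D.overIn c) = -D.alternating (D.underIn c) := by
  have h := (hD c).neg_one_pow (α := ℤˣ)
  rw [pow_add] at h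
  simp only [alternating, underIn_val, overIn_val]
  rcases neg_one_pow_eq_or ℤˣ (D.visit (Sum.inl c) : ℕ) with h1 | h1 <;> rw [h1] at h ⊢ <;>
    simpa [neg_eq_iff_eq_neg] using h

lemma isColouring_alternating (hD : D.IsEven) : IsColouring D.orientedVertex D.alternating := by
  rw [isColouring_iff]
  refine ⟨by simp [alternating], fun c => ⟨fun _ => ?_, fun h =>
    absurd h (positive_ne_orientedVertex c)⟩⟩
  have h1 := alternating_passage c
  have h2 := alternating_overIn hD c
  rw [h1.1, h1.2, h2, neg_neg]
  exact ⟨rfl, rfl⟩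

/-- The alternating colouring and its negative occur at the oriented resolution only. -/
lemma eq_orientedVertex_of_isColouring (hD : D.IsEven) {v : D.Vertex}
    (h : IsColouring v D.alternating) : v = D.orientedVertex := by
  funext c
  have hc : D.positive c ≠ v c := fun hc => by
    have h1 := (((isColouring_iff.1 h).2 c).2 hc).1
    rw [alternating_overIn hD] at h1
    exact Int.units_ne_iff_eq_neg.2 h1 rfl
  unfold orientedVertex
  revert hc
  cases D.positive c <;> cases v c <;> simp

namespace RootExtension

variable (A : RootExtension R t K)

/-- The values of a chain under the two characters at the oriented resolution given by the
alternating colouring (`u = 1`) and its negative (`u = -1`). -/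
def value (u : ℤˣ) (z : D.Chain R t) : K := A.edgeEval D.orientedVertex (u • D.alternating) (z _)

lemma isColouring_smul_alternating (hD : D.IsEven) (u : ℤˣ) :
    IsColouring D.orientedVertex (u • D.alternating) := fun a b h => by
  rw [Pi.smul_apply, Pi.smul_apply, isColouring_alternating hD a b h]

lemma value_add (u : ℤˣ) (z z' : D.Chain R t) : A.value u (z + z') = A.value u z + A.value u z' :=
  map_add _ _ _

lemma value_smul (u : ℤˣ) (r : R) (z : D.Chain R t) : A.value u (r • z) = A.toHom r * A.value u z :=
  A.edgeEval_smul _ _ _ _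

lemma value_xChain (hD : D.IsEven) (u : ℤˣ) (z : D.Chain R t) :
    A.value u (D.xChain R t z) = ((u : ℤ) : K) * A.root * A.value u z := by
  rw [value, xChain_apply, map_mul, A.edgeEval_gen (isColouring_smul_alternating hD u), mul_comm,
    Pi.smul_apply, alternating_zero, smul_eq_mul, mul_one, value]

/-- All edge maps into the oriented resolution are zero on the alternating colour. -/
lemma value_differential (hD : D.IsEven) (u : ℤˣ) (z : D.Chain R t) :
    A.value u (D.differential R t z) = 0 := by
  rw [value, differential_apply, map_sum]
  refine Finset.sum_eq_zero fun c hc => ?_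
  rw [Finset.mem_filter] at hc
  have hcol := isColouring_smul_alternating hD u
  rw [map_zsmul, A.edgeEval_edgeMap hcol,
    A.edgeScalar_eq_zero hD hcol (adj_update_false hc.2).symm, zero_mul, smul_zero]
  rw [Pi.smul_apply, Pi.smul_apply, (alternating_passage c).1, smul_eq_mul, smul_eq_mul, mul_neg]
  exact Int.units_ne_iff_eq_neg.2 (neg_neg _).symm

/-- The composite, over the first `k` edges `e`, of the operators `X_e + (-1) ^ e X_0`. -/
def alternatingProduct (z : D.Chain R t) : ℕ → D.Chain R t
  | 0 => z
  | k + 1 => if h : k < 2 * D.n + 1 then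
      edgeChain ⟨k, h⟩ (alternatingProduct z k) +
        ((-1 : ℤ) ^ k) • edgeChain 0 (alternatingProduct z k)
      else alternatingProduct z k

lemma edgeEval_edgeChain {v : D.Vertex} {ε : D.Edge → ℤˣ} (h : IsColouring v ε) (e : D.Edge)
    (z : D.Chain R t) :
    A.edgeEval v ε (edgeChain e z v) = A.edgeEval v ε (z v) * (((ε e : ℤ) : K) * A.root) := by
  rw [edgeChain_apply, map_mul, A.edgeEval_gen h]

/-- The colours other than the alternating one and its negative are annihilated. -/
lemma edgeEval_alternatingProduct_eq_zero {v : D.Vertex} {ε : D.Edge → ℤˣ} (h : IsColouring v ε)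
    (z : D.Chain R t) (k : ℕ)
    (hz : A.edgeEval v ε (z v) = 0 ∨
      ∃ e : D.Edge, (e : ℕ) < k ∧ ε e ≠ ε 0 * D.alternating e) :
    A.edgeEval v ε (alternatingProduct z k v) = 0 := by
  induction k with
  | zero => simpa [alternatingProduct] using hz
  | succ k ih =>
    rw [alternatingProduct]
    split_ifs with hk
    · rw [Pi.add_apply, Pi.smul_apply, map_add, map_zsmul, A.edgeEval_edgeChain h,
        A.edgeEval_edgeChain h]
      rcases hz with hz | ⟨e, he, hne⟩
      · simp [ih (Or.inl hz)]
      rcases Nat.lt_succ_iff_lt_or_eq.1 he with he | he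
      · simp [ih (Or.inr ⟨e, he, hne⟩)]
      · have : e = ⟨k, hk⟩ := Fin.ext he
        subst this
        have h1 : ε ⟨k, hk⟩ = -(ε 0 * (-1) ^ k) := Int.units_ne_iff_eq_neg.1 hne
        rw [h1, zsmul_eq_mul]
        push_cast
        ring
    · refine ih ?_
      rcases hz with hz | ⟨e, he, hne⟩
      · exact Or.inl hz
      · exact Or.inr ⟨e, by have := e.isLt; omega, hne⟩

lemma value_alternatingProduct (hD : D.IsEven) (u : ℤˣ) (z : D.Chain R t) {k : ℕ}
    (hk : k ≤ 2 * D.n + 1) :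
    ∃ w : ℤˣ, A.value u (alternatingProduct z k) =
      ((w : ℤ) : K) * (2 * A.root) ^ k * A.value u z := by
  induction k with
  | zero => exact ⟨1, by simp [alternatingProduct]⟩
  | succ k ih =>
    obtain ⟨w, hw⟩ := ih (by omega)
    refine ⟨w * u * (-1) ^ k, ?_⟩
    have hcol := isColouring_smul_alternating hD u
    rw [value] at hw
    rw [alternatingProduct, dif_pos (by omega), value, Pi.add_apply, Pi.smul_apply, map_add,
      map_zsmul, A.edgeEval_edgeChain hcol, A.edgeEval_edgeChain hcol, hw]
    simp only [Pi.smul_apply, alternating, smul_eq_mul, Fin.val_zero, pow_zero, mul_one,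
      zsmul_eq_mul]
    push_cast
    ring

variable [IsDomain K] [CharZero K]
include A

/-- The oriented resolution carries a cycle in the alternating colour. -/
lemma exists_cycle_value (hD : D.IsEven) : ∃ z : D.Chain R t, D.differential R t z = 0 ∧
    ∃ w : ℤˣ, A.value 1 z = ((w : ℤ) : K) * (2 * A.root) ^ (2 * D.n + 1) := by
  classical
  set z : D.Chain R t := alternatingProduct (Pi.single D.orientedVertex 1) (2 * D.n + 1) with hz
  refine ⟨z, ?_, ?_⟩
  · have hsupp : ∀ v, v ≠ D.orientedVertex → z v = 0 := fun v hv => by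
      refine A.edgeEval_ext fun ε hε => ?_
      rw [map_zero]
      refine A.edgeEval_alternatingProduct_eq_zero hε _ _ (Or.inl ?_)
      rw [Pi.single_eq_of_ne hv, map_zero]
    funext w
    refine A.edgeEval_ext fun ε hw => ?_
    rw [differential_apply, map_sum, Pi.zero_apply, map_zero]
    refine Finset.sum_eq_zero fun c hc => ?_
    rw [Finset.mem_filter] at hc
    have hadj := (adj_update_false hc.2).symm
    rw [map_zsmul, A.edgeEval_edgeMap hw]
    by_cases hεc : ε (D.underIn c) = ε (D.underOut c)
    · by_cases hv : Function.update w c false = D.orientedVertex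
      · have : A.edgeEval (Function.update w c false) ε (z (Function.update w c false)) = 0 := by
          refine A.edgeEval_alternatingProduct_eq_zero (hw.of_adj hadj hεc) _ _ (Or.inr ?_)
          by_contra hall
          push Not at hall
          have h1 := hall (D.underIn c) (D.underIn c).isLt
          rw [hεc, hall (D.underOut c) (D.underOut c).isLt, mul_right_inj,
            (alternating_passage c).1] at h1
          exact Int.units_ne_iff_eq_neg.2 rfl h1
        rw [this, mul_zero, smul_zero]
      · rw [hsupp _ hv, map_zero, mul_zero, smul_zero]
    · rw [A.edgeScalar_eq_zero hD hw hadj hεc, zero_mul, smul_zero]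
  · obtain ⟨w, hw⟩ := A.value_alternatingProduct hD 1
      (Pi.single D.orientedVertex 1 : D.Chain R t) le_rfl
    refine ⟨w, hw.trans ?_⟩
    rw [value, Pi.single_eq_same, map_one, mul_one]

/-- Up to boundaries and sign, the operator `X_e + (-1) ^ e X_0` acts on cycles as `2 X_0`. -/
lemma alternatingProduct_spec (hD : D.IsEven) {z : D.Chain R t} (hz : D.differential R t z = 0)
    {k : ℕ} (hk : k ≤ 2 * D.n + 1) :
    D.differential R t (alternatingProduct z k) = 0 ∧ ∃ u : ℤˣ,
      alternatingProduct z k - (u : ℤ) • (2 : ℤ) ^ k • (edgeChain 0 ^ k) z ∈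
        LinearMap.range (D.differential R t) := by
  induction k with
  | zero => exact ⟨hz, 1, by simp [alternatingProduct]⟩
  | succ k ih =>
    obtain ⟨hy, u, hu⟩ := ih (by omega)
    set y := alternatingProduct z k with hy'
    rw [alternatingProduct, dif_pos (by omega), ← hy']
    refine ⟨?_, u * (-1) ^ k, ?_⟩
    · rw [map_add, map_zsmul, A.differential_edgeChain hD, A.differential_edgeChain hD, hy]
      simp
    · have h1 := A.edgeChain_sub_mem_range hD hy ⟨k, by omega⟩
      have h2 : edgeChain 0 (y - (u : ℤ) • (2 : ℤ) ^ k • (edgeChain 0 ^ k) z) ∈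
          LinearMap.range (D.differential R t) := by
        obtain ⟨x, hx⟩ := hu
        exact ⟨edgeChain 0 x, by rw [A.differential_edgeChain hD, hx]⟩
      have h3 := Submodule.add_mem _ h1 (Submodule.smul_of_tower_mem _ (2 * (-1 : ℤ) ^ k) h2)
      convert h3 using 1
      rw [map_sub, map_zsmul, map_zsmul, pow_succ' (edgeChain 0), Module.End.mul_apply]
      simp only [Units.val_mul, Units.val_pow_eq_pow_val, Units.val_neg, Units.val_one]
      module

/-- A cycle on which both characters at the oriented resolution vanish is a boundary up to powers of
`2` and `t`. -/
theorem smul_mem_range_of_value_eq_zero (hD : D.IsEven) {z : D.Chain R t}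
    (hz : D.differential R t z = 0) (h : ∀ u, A.value u z = 0) :
    ((2 : R) ^ (2 * D.n + 1) * t ^ (2 * D.n + 1)) • z ∈ LinearMap.range (D.differential R t) := by
  have h0 : alternatingProduct z (2 * D.n + 1) = 0 := by
    funext v
    refine A.edgeEval_ext fun ε hε => ?_
    rw [Pi.zero_apply, map_zero]
    refine A.edgeEval_alternatingProduct_eq_zero hε z _ ?_
    by_cases hall : ∀ e, ε e = ε 0 * D.alternating e
    · left
      have hε' : ε = ε 0 • D.alternating := funext hall
      have halt : IsColouring v D.alternating := fun a b hab => by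
        have := hε a b hab
        rwa [hall a, hall b, mul_right_inj] at this
      obtain rfl := eq_orientedVertex_of_isColouring hD halt
      rw [hε']
      exact h (ε 0)
    · right
      push Not at hall
      obtain ⟨e, he⟩ := hall
      exact ⟨e, e.isLt, he⟩
  obtain ⟨-, u, hu⟩ := A.alternatingProduct_spec hD hz le_rfl
  rw [h0, zero_sub, Submodule.neg_mem_iff] at hu
  have hstep : ∀ k : ℕ, ∀ y ∈ LinearMap.range (D.differential R t),
      (edgeChain 0 ^ k) y ∈ LinearMap.range (D.differential R t) := by
    rintro k _ ⟨x, rfl⟩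
    induction k with
    | zero => exact ⟨x, rfl⟩
    | succ k ih =>
      obtain ⟨y, hy⟩ := ih
      exact ⟨edgeChain 0 y, by
        rw [A.differential_edgeChain hD, hy, pow_succ', Module.End.mul_apply]⟩
  have hpow : ∀ k : ℕ, (edgeChain 0 ^ k) ((edgeChain 0 ^ k) z) = t ^ k • z := by
    intro k
    rw [← Module.End.mul_apply, ← (Commute.refl _).mul_pow]
    have : (edgeChain 0 * edgeChain 0 : D.Chain R t →ₗ[R] D.Chain R t) = t • 1 := by
      exact LinearMap.ext fun y => edgeChain_edgeChain 0 y
    rw [this, smul_pow, one_pow]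
    rfl
  have := Submodule.smul_of_tower_mem _ (u : ℤ) (hstep (2 * D.n + 1) _ hu)
  rw [map_zsmul, map_zsmul, hpow, smul_smul, ← Units.val_mul, Int.units_mul_self, Units.val_one,
    one_smul] at this
  convert this using 1
  rw [mul_smul, ← Int.cast_smul_eq_zsmul R]
  push_cast
  rfl

end RootExtension

end GaussCode

/-! ### The grading of the complex over `ℚ[t]` -/

namespace GaussCode

section Homogeneous

variable {S : Type}

local notation "𝒜" => TensorPower ℚ[X] Polynomial.X

/-- The elements of degree `k` in the tensor power over `ℚ[t]`, where `t` has degree `4`, `X` has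
degree `2` and `1` has degree `0`. -/
def homogeneous (S : Type) (k : ℤ) : Submodule ℚ (𝒜 S) :=
  Submodule.span ℚ {x | ∃ (a : ℕ) (T : Finset S), 4 * (a : ℤ) + 2 * T.card = k ∧
    x = (Polynomial.X ^ a : ℚ[X]) • monomial ℚ[X] Polynomial.X T}

lemma smul_monomial_mem_homogeneous (a : ℕ) (T : Finset S) :
    (Polynomial.X ^ a : ℚ[X]) • monomial ℚ[X] Polynomial.X T ∈
      homogeneous S (4 * (a : ℤ) + 2 * T.card) :=
  Submodule.subset_span ⟨a, T, rfl, rfl⟩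

lemma one_mem_homogeneous : (1 : 𝒜 S) ∈ homogeneous S 0 := by
  simpa [monomial] using smul_monomial_mem_homogeneous 0 (∅ : Finset S)

lemma smul_mem_homogeneous {k : ℤ} {x : 𝒜 S} (hx : x ∈ homogeneous S k) (a : ℕ) :
    (Polynomial.X ^ a : ℚ[X]) • x ∈ homogeneous S (k + 4 * a) := by
  induction hx using Submodule.span_induction with
  | mem _ h =>
    obtain ⟨b, T, hk, rfl⟩ := h
    rw [smul_smul, ← pow_add]
    exact Submodule.subset_span ⟨a + b, T, by push_cast; omega, rfl⟩
  | zero => rw [smul_zero]; exact Submodule.zero_mem _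
  | add x y _ _ hx hy => rw [smul_add]; exact Submodule.add_mem _ hx hy
  | smul q x _ hx =>
    rw [← algebraMap_smul ℚ[X] q x, smul_smul, mul_comm (Polynomial.X ^ a), mul_smul,
      algebraMap_smul]
    exact Submodule.smul_mem _ _ hx

lemma mul_gen_mem_homogeneous {k : ℤ} {x : 𝒜 S} (hx : x ∈ homogeneous S k) (s : S) :
    x * gen ℚ[X] Polynomial.X s ∈ homogeneous S (k + 2) := by
  classical
  induction hx using Submodule.span_induction with
  | mem _ h =>
    obtain ⟨a, T, hk, rfl⟩ := h
    rw [smul_mul_assoc]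
    by_cases hs : s ∈ T
    · rw [monomial_mul_gen_of_mem hs, smul_smul, ← pow_succ]
      refine Submodule.subset_span ⟨a + 1, T.erase s, ?_, rfl⟩
      have := Finset.card_erase_add_one hs
      push_cast
      omega
    · rw [monomial_mul_gen_of_notMem hs]
      refine Submodule.subset_span ⟨a, insert s T, ?_, rfl⟩
      rw [Finset.card_insert_of_notMem hs]
      push_cast
      omega
  | zero => rw [zero_mul]; exact Submodule.zero_mem _
  | add x y _ _ hx hy => rw [add_mul]; exact Submodule.add_mem _ hx hy
  | smul q x _ hx => rw [smul_mul_assoc]; exact Submodule.smul_mem _ _ hx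

lemma tensorMap_mem_homogeneous {S' : Type} (f : S → S') {k : ℤ} {x : 𝒜 S}
    (hx : x ∈ homogeneous S k) : tensorMap ℚ[X] Polynomial.X f x ∈ homogeneous S' k := by
  classical
  induction hx using Submodule.span_induction with
  | mem _ h =>
    obtain ⟨a, T, hk, rfl⟩ := h
    have h1 : tensorMap ℚ[X] Polynomial.X f (monomial ℚ[X] Polynomial.X T) ∈
        homogeneous S' (2 * T.card) := by
      clear hk
      induction T using Finset.induction_on with
      | empty => simpa [monomial] using one_mem_homogeneous
      | insert s T hs ih =>
        rw [← monomial_mul_gen_of_notMem hs, map_mul, tensorMap_gen,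
          Finset.card_insert_of_notMem hs]
        have := mul_gen_mem_homogeneous ih (f s)
        push_cast
        rwa [mul_add]
    rw [map_smul]
    have := smul_mem_homogeneous h1 a
    rwa [show (2 * T.card + 4 * a : ℤ) = k by omega] at this
  | zero => rw [map_zero]; exact Submodule.zero_mem _
  | add x y _ _ hx hy => rw [map_add]; exact Submodule.add_mem _ hx hy
  | smul q x _ hx =>
    rw [← algebraMap_smul ℚ[X] q x, map_smul, algebraMap_smul]
    exact Submodule.smul_mem _ _ hx

lemma mem_iSup_homogeneous (x : 𝒜 S) : x ∈ ⨆ k, homogeneous S k := by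
  refine tensorPower_induction (U := (⨆ k, homogeneous S k).toAddSubgroup) ?_ ?_ x
  · intro p
    rw [Submodule.mem_toAddSubgroup]
    induction p using Polynomial.induction_on' with
    | add p q hp hq => rw [add_smul]; exact Submodule.add_mem _ hp hq
    | monomial n q =>
      rw [← Polynomial.C_mul_X_pow_eq_monomial, ← Polynomial.smul_eq_C_mul, smul_assoc]
      exact Submodule.smul_mem _ _
        (Submodule.mem_iSup_of_mem _ (smul_mem_homogeneous one_mem_homogeneous n))
  · intro a ha s
    rw [Submodule.mem_toAddSubgroup] at ha ⊢
    induction ha using Submodule.iSup_induction' with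
    | mem k x hx => exact Submodule.mem_iSup_of_mem _ (mul_gen_mem_homogeneous hx s)
    | zero => rw [zero_mul]; exact Submodule.zero_mem _
    | add x y _ _ hx hy => rw [add_mul]; exact Submodule.add_mem _ hx hy

end Homogeneous

variable {D : GaussCode}

/-- The difference between twice the exponent of `X` and the `q`-degree at the vertex `v`. -/
def degreeShift (v : D.Vertex) : ℤ := D.numCircles v + D.weight v + D.nPos - 2 * D.nNeg

lemma mem_chainsOfDegree {j : ℤ} {z : D.Chain ℚ[X] Polynomial.X} :
    z ∈ D.chainsOfDegree j ↔ ∀ v, z v ∈ homogeneous (D.Circle v) (j + degreeShift v) := by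
  rw [chainsOfDegree, Submodule.mem_pi]
  simp only [Set.mem_univ, true_imp_iff, homogeneous]
  refine forall_congr' fun v => ?_
  have : ∀ (a : ℕ) (T : Finset (D.Circle v)),
      4 * (a : ℤ) + 2 * T.card - D.numCircles v - D.weight v - D.nPos + 2 * D.nNeg = j ↔
        4 * (a : ℤ) + 2 * T.card = j + degreeShift v := fun a T => by
    unfold degreeShift
    omega
  refine iff_of_eq (congrArg (fun U => z v ∈ Submodule.span ℚ U) (Set.ext fun x => ?_))
  exact exists_congr fun a => exists_congr fun T => and_congr_left' (this a T)

lemma edgeMap_mem_homogeneous (hD : D.IsEven) {v w : D.Vertex} {c : Fin D.n} (h : Adj v w c)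
    {k : ℤ} {x : D.VertexModule ℚ[X] Polynomial.X v} (hx : x ∈ homogeneous (D.Circle v) k) :
    D.edgeMap ℚ[X] Polynomial.X v w c x ∈
      homogeneous (D.Circle w) (k + D.numCircles w - D.numCircles v + 1) := by
  have hx' := tensorMap_mem_homogeneous (fun s : D.Circle v => D.circle w (D.firstEdge s)) hx
  simp only [edgeMap, LinearMap.comp_apply, AlgHom.toLinearMap_apply, LinearMap.mulRight_apply,
    edgeFactor]
  split_ifs with hv
  · rw [mul_add, show k + D.numCircles w - D.numCircles v + 1 = k + 2 by
      rw [h.numCircles_split hD hv]; push_cast; ring]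
    exact Submodule.add_mem _ (mul_gen_mem_homogeneous hx' _) (mul_gen_mem_homogeneous hx' _)
  · rw [mul_one, show k + D.numCircles w - D.numCircles v + 1 = k by
      rw [← h.numCircles_merge hD hv]; push_cast; ring]
    exact hx'

lemma weight_update_false {v : D.Vertex} {c : Fin D.n} (h : v c = true) :
    D.weight (Function.update v c false) + 1 = D.weight v := by
  have := weight_update_true (v := Function.update v c false) (c := c) (by simp)
  rw [Function.update_idem, Function.update_eq_self_iff.2 h.symm] at this
  exact this.symm

lemma differential_mem_chainsOfDegree (hD : D.IsEven) {j : ℤ} {z : D.Chain ℚ[X] Polynomial.X}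
    (hz : z ∈ D.chainsOfDegree j) :
    D.differential ℚ[X] Polynomial.X z ∈ D.chainsOfDegree j := by
  rw [mem_chainsOfDegree] at hz ⊢
  intro w
  rw [differential_apply]
  refine Submodule.sum_mem _ fun c hc => Submodule.smul_of_tower_mem _ _ ?_
  rw [Finset.mem_filter] at hc
  have := edgeMap_mem_homogeneous hD (adj_update_false hc.2).symm
    (hz (Function.update w c false))
  have hw := weight_update_false hc.2
  have e : j + degreeShift w = j + degreeShift (Function.update w c false) + D.numCircles w -
      D.numCircles (Function.update w c false) + 1 := by
    unfold degreeShift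
    omega
  rw [e]
  exact this

lemma xChain_mem_chainsOfDegree {j : ℤ} {z : D.Chain ℚ[X] Polynomial.X}
    (hz : z ∈ D.chainsOfDegree j) :
    D.xChain ℚ[X] Polynomial.X z ∈ D.chainsOfDegree (j + 2) := by
  rw [mem_chainsOfDegree] at hz ⊢
  intro v
  rw [add_right_comm]
  exact mul_gen_mem_homogeneous (hz v) _

/-- Every chain is a sum of homogeneous ones. -/
lemma exists_sum_chainsOfDegree (z : D.Chain ℚ[X] Polynomial.X) :
    ∃ f : ℤ →₀ D.Chain ℚ[X] Polynomial.X, (∀ j, f j ∈ D.chainsOfDegree j) ∧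
      ∑ j ∈ f.support, f j = z := by
  classical
  suffices h : z ∈ ⨆ j, D.chainsOfDegree j from
    (Submodule.mem_iSup_iff_exists_finsupp _ _).1 h
  rw [← Finset.univ_sum_single z]
  refine Submodule.sum_mem _ fun v _ => ?_
  have := mem_iSup_homogeneous (z v)
  generalize z v = x at this
  induction this using Submodule.iSup_induction' with
  | mem k x hx =>
    refine Submodule.mem_iSup_of_mem (k - degreeShift v) (mem_chainsOfDegree.2 fun w => ?_)
    rcases eq_or_ne w v with rfl | hw
    · rwa [Pi.single_eq_same, sub_add_cancel]
    · rw [Pi.single_eq_of_ne hw]; exact Submodule.zero_mem _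
  | zero => rw [Pi.single_zero]; exact Submodule.zero_mem _
  | add x y _ _ hx hy => rw [Pi.single_add]; exact Submodule.add_mem _ hx hy

/-- The extension of `ℚ[t]` by a square root of `t`. -/
def polynomialRoot : RootExtension ℚ[X] Polynomial.X ℚ[X] where
  toHom := (Polynomial.expand ℚ 2 : ℚ[X] →+* ℚ[X])
  injective := Polynomial.expand_injective two_pos
  root := Polynomial.X
  root_sq := (Polynomial.expand_X 2).symm
  root_ne_zero := Polynomial.X_ne_zero

lemma polynomialRoot_toHom (p : ℚ[X]) : polynomialRoot.toHom p = Polynomial.expand ℚ 2 p := rfl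

lemma polynomialRoot_root : polynomialRoot.root = Polynomial.X := rfl

/-- The characters map homogeneous elements to multiples of powers of `X`. -/
lemma coeff_eval_homogeneous {S : Type} (ε : S → ℤˣ) {k : ℤ}
    {x : TensorPower ℚ[X] Polynomial.X S} (hx : x ∈ homogeneous S k) {i : ℕ}
    (hi : (polynomialRoot.eval ε x).coeff i ≠ 0) : 2 * (i : ℤ) = k := by
  by_contra hne
  refine hi ?_
  clear hi
  induction hx using Submodule.span_induction with
  | mem _ h =>
    obtain ⟨a, T, hk, rfl⟩ := h
    have hC : (∏ s ∈ T, ((ε s : ℤ) : ℚ[X])) = Polynomial.C (∏ s ∈ T, ((ε s : ℤ) : ℚ)) := by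
      simp
    rw [RootExtension.eval_smul, RootExtension.eval_monomial, polynomialRoot_toHom,
      polynomialRoot_root, map_pow, Polynomial.expand_X, ← pow_mul, hC, mul_left_comm, ← pow_add,
      Polynomial.coeff_C_mul_X_pow, if_neg]
    intro h
    omega
  | zero => rw [map_zero, Polynomial.coeff_zero]
  | add x y _ _ hx hy =>
    rw [map_add, Polynomial.coeff_add, hx, hy, add_zero]
  | smul q x _ hx =>
    rw [← algebraMap_smul ℚ[X] q x, RootExtension.eval_smul, polynomialRoot_toHom,
      Polynomial.algebraMap_eq, Polynomial.expand_C, Polynomial.coeff_C_mul,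
      hx, mul_zero]

lemma exists_eq_C_mul_X_pow {p : ℚ[X]} {k : ℤ} (hp : ∀ i : ℕ, p.coeff i ≠ 0 → 2 * (i : ℤ) = k) :
    ∃ i : ℕ, p = Polynomial.C (p.coeff i) * Polynomial.X ^ i := by
  refine ⟨p.natDegree, ?_⟩
  by_cases hp0 : p = 0
  · simp [hp0]
  · have h1 := hp p.natDegree (by simpa using hp0)
    ext i
    rw [Polynomial.coeff_C_mul_X_pow]
    split_ifs with hi
    · rw [hi]
    · by_contra hi'
      have := hp i hi'
      omega

lemma coeff_edgeEval {j : ℤ} {z : D.Chain ℚ[X] Polynomial.X} (hz : z ∈ D.chainsOfDegree j)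
    {v : D.Vertex} {ε : D.Edge → ℤˣ} {i : ℕ}
    (hi : (polynomialRoot.edgeEval v ε (z v)).coeff i ≠ 0) : 2 * (i : ℤ) = j + degreeShift v :=
  coeff_eval_homogeneous _ (mem_chainsOfDegree.1 hz v) hi

/-- Chains of different degrees are linearly independent. -/
lemma eq_zero_of_sum_chainsOfDegree {s : Finset ℤ} {f : ℤ → D.Chain ℚ[X] Polynomial.X}
    (hf : ∀ j, f j ∈ D.chainsOfDegree j) (h : ∑ j ∈ s, f j = 0) {j : ℤ} (hj : j ∈ s) :
    f j = 0 := by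
  funext v
  refine polynomialRoot.edgeEval_ext fun ε _ => ?_
  rw [Pi.zero_apply, map_zero]
  ext i
  rw [Polynomial.coeff_zero]
  by_contra hi
  have hij := coeff_edgeEval (hf j) hi
  refine hi ?_
  have h1 := congrArg (fun z : D.Chain ℚ[X] Polynomial.X =>
    (polynomialRoot.edgeEval v ε (z v)).coeff i) h
  simp only [Finset.sum_apply, map_sum, Polynomial.finsetSum_coeff, Pi.zero_apply, map_zero,
    Polynomial.coeff_zero] at h1
  rwa [Finset.sum_eq_single_of_mem j hj] at h1
  intro j' _ hne
  by_contra hi'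
  exact hne (by have := coeff_edgeEval (hf j') hi'; omega)

/-- The homogeneous components of a cycle are cycles. -/
lemma exists_sum_cycles_of_degree (hD : D.IsEven) {z : D.Chain ℚ[X] Polynomial.X}
    (hz : D.differential ℚ[X] Polynomial.X z = 0) :
    ∃ f : ℤ →₀ D.Chain ℚ[X] Polynomial.X, (∀ j, f j ∈ D.chainsOfDegree j ∧
      D.differential ℚ[X] Polynomial.X (f j) = 0) ∧ ∑ j ∈ f.support, f j = z := by
  obtain ⟨f, hf, hfz⟩ := exists_sum_chainsOfDegree z
  refine ⟨f, fun j => ⟨hf j, ?_⟩, hfz⟩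
  by_cases hj : j ∈ f.support
  · refine eq_zero_of_sum_chainsOfDegree (s := f.support)
      (f := fun j => D.differential ℚ[X] Polynomial.X (f j))
      (fun j => differential_mem_chainsOfDegree hD (hf j)) ?_ hj
    rw [← map_sum, hfz, hz]
  · rw [Finsupp.notMem_support_iff.1 hj, map_zero]

/-! ### The part of a chain in cohomological degree zero -/

section Truncate

variable {R : Type} [CommRing R] {t : R}

/-- The component of a chain in cohomological degree zero. -/
def truncate (z : D.Chain R t) : D.Chain R t := fun v => if D.weight v = D.nNeg then z v else 0

lemma truncate_orientedVertex (z : D.Chain R t) :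
    truncate z D.orientedVertex = z D.orientedVertex := if_pos weight_orientedVertex

lemma truncate_mem_cycles {z : D.Chain R t} (hz : D.differential R t z = 0) :
    truncate z ∈ D.cycles R t 0 := by
  refine ⟨?_, fun v hv => if_neg (by omega)⟩
  funext w
  rw [differential_apply]
  by_cases hw : D.weight w = D.nNeg + 1
  · have := congrFun hz w
    rw [differential_apply] at this
    refine (Finset.sum_congr rfl fun c hc => ?_).trans this
    rw [Finset.mem_filter] at hc
    have := weight_update_false hc.2
    rw [truncate, if_pos (by omega)]
  · refine Finset.sum_eq_zero fun c hc => ?_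
    rw [Finset.mem_filter] at hc
    have := weight_update_false hc.2
    rw [truncate, if_neg (by omega), map_zero, smul_zero]

lemma truncate_mem_chainsOfDegree {j : ℤ} {z : D.Chain ℚ[X] Polynomial.X}
    (hz : z ∈ D.chainsOfDegree j) : truncate z ∈ D.chainsOfDegree j := by
  rw [mem_chainsOfDegree] at hz ⊢
  intro v
  unfold truncate
  split_ifs
  · exact hz v
  · exact Submodule.zero_mem _

end Truncate

/-! ### The ideal of values of cycles -/

lemma value_rat_smul (u : ℤˣ) (q : ℚ) (z : D.Chain ℚ[X] Polynomial.X) :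
    polynomialRoot.value u (q • z) = q • polynomialRoot.value u z := by
  rw [← algebraMap_smul ℚ[X] q z, RootExtension.value_smul, polynomialRoot_toHom,
    Polynomial.algebraMap_eq, Polynomial.expand_C, Polynomial.smul_eq_C_mul]

/-- The ideal of the values of cycles at the alternating colouring.  It turns out to be isomorphic
to cohomology modulo torsion. -/
def valueIdeal (hD : D.IsEven) : Ideal ℚ[X] where
  carrier := {p | ∃ z : D.Chain ℚ[X] Polynomial.X,
    D.differential ℚ[X] Polynomial.X z = 0 ∧ polynomialRoot.value 1 z = p}
  zero_mem' := ⟨0, map_zero _, map_zero _⟩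
  add_mem' := by
    rintro _ _ ⟨z, hz, rfl⟩ ⟨z', hz', rfl⟩
    exact ⟨z + z', by rw [map_add, hz, hz', add_zero], RootExtension.value_add _ _ _ _⟩
  smul_mem' := by
    intro p
    induction p using Polynomial.induction_on' with
    | add p q hp hq =>
      intro x hx
      obtain ⟨z, hz, h⟩ := hp hx
      obtain ⟨z', hz', h'⟩ := hq hx
      exact ⟨z + z', by rw [map_add, hz, hz', add_zero], by
        rw [RootExtension.value_add, h, h', add_smul]⟩
    | monomial n q =>
      induction n with
      | zero =>
        rintro _ ⟨z, hz, rfl⟩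
        refine ⟨q • z, ?_, ?_⟩
        · rw [← algebraMap_smul ℚ[X] q z, map_smul, hz, smul_zero]
        · rw [value_rat_smul, Polynomial.monomial_zero_left, Polynomial.smul_eq_C_mul, smul_eq_mul]
      | succ n ih =>
        intro x hx
        obtain ⟨z, hz, h⟩ := ih hx
        refine ⟨D.xChain ℚ[X] Polynomial.X z, ?_, ?_⟩
        · rw [differential_xChain, hz, map_zero]
        · rw [RootExtension.value_xChain _ hD, h, polynomialRoot_root, smul_eq_mul, smul_eq_mul,
            ← Polynomial.monomial_mul_X]
          simp only [Units.val_one, Int.cast_one, one_mul]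
          ring

/-- The ideal of values is generated by a power of `X`, which is the value of a homogeneous cycle in
cohomological degree zero. -/
lemma exists_generator (hD : D.IsEven) : ∃ m : ℕ,
    (∀ z : D.Chain ℚ[X] Polynomial.X, D.differential ℚ[X] Polynomial.X z = 0 →
      Polynomial.X ^ m ∣ polynomialRoot.value 1 z) ∧
    ∃ z ∈ D.cycles ℚ[X] Polynomial.X 0,
      z ∈ D.chainsOfDegree (2 * m - degreeShift D.orientedVertex) ∧
      polynomialRoot.value 1 z = Polynomial.X ^ m := by
  obtain ⟨g, hg⟩ := (IsPrincipalIdealRing.principal (valueIdeal hD)).principal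
  have hg' : valueIdeal hD = Ideal.span {g} := hg
  -- the ideal contains a power of `X`
  obtain ⟨z, hz, w, hw⟩ := polynomialRoot.exists_cycle_value hD
  have h1 : g ∣ Polynomial.X ^ (2 * D.n + 1) := by
    have h2 : polynomialRoot.value 1 z ∈ valueIdeal hD := ⟨z, hz, rfl⟩
    rw [hg', Ideal.mem_span_singleton, hw, polynomialRoot_root, mul_pow, ← mul_assoc] at h2
    refine (IsUnit.dvd_mul_left ?_).1 h2
    refine IsUnit.mul ((w.isUnit.map (Int.castRingHom ℚ[X]))) (IsUnit.pow _ ?_)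
    exact (IsUnit.mk0 (2 : ℚ) two_ne_zero).map Polynomial.C
  obtain ⟨m, -, hm⟩ := (dvd_prime_pow Polynomial.prime_X _).1 h1
  refine ⟨m, fun z hz => hm.symm.dvd.trans ?_, ?_⟩
  · rw [← Ideal.mem_span_singleton, ← hg']
    exact ⟨z, hz, rfl⟩
  have h3 : (Polynomial.X ^ m : ℚ[X]) ∈ valueIdeal hD := by
    rw [hg', Ideal.mem_span_singleton]
    exact hm.dvd
  obtain ⟨z, hz, hzm⟩ := h3
  obtain ⟨f, hf, hfz⟩ := exists_sum_cycles_of_degree hD hz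
  set j : ℤ := 2 * m - degreeShift D.orientedVertex with hj
  refine ⟨truncate (f j), truncate_mem_cycles (hf j).2, truncate_mem_chainsOfDegree (hf j).1, ?_⟩
  rw [RootExtension.value, truncate_orientedVertex]
  ext i
  by_cases hi : i = m
  · subst hi
    rw [← hzm, ← hfz, RootExtension.value, Finset.sum_apply, map_sum,
      Polynomial.finsetSum_coeff]
    by_cases hjs : j ∈ f.support
    · rw [Finset.sum_eq_single_of_mem j hjs]
      intro j' _ hne
      by_contra hi'
      exact hne (by have := coeff_edgeEval (hf j').1 hi'; omega)
    · rw [Finset.sum_eq_zero, Finsupp.notMem_support_iff.1 hjs, Pi.zero_apply, map_zero,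
        Polynomial.coeff_zero]
      intro j' hj'
      by_contra hi'
      have := coeff_edgeEval (hf j').1 hi'
      exact hjs ((by omega : j' = j) ▸ hj')
  · rw [Polynomial.coeff_X_pow, if_neg hi]
    by_contra hi'
    have := coeff_edgeEval (hf j).1 hi'
    omega

lemma polynomialRoot_eval_neg {S : Type} (ε : S → ℤˣ) (x : TensorPower ℚ[X] Polynomial.X S) :
    polynomialRoot.eval (-ε) x = (polynomialRoot.eval ε x).comp (-Polynomial.X) := by
  have : polynomialRoot.eval (-ε) =
      (Polynomial.compRingHom (-Polynomial.X)).comp (polynomialRoot.eval ε) := by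
    refine tensorPower_hom_ext (fun r => ?_) fun s => ?_
    · simp [polynomialRoot_toHom, Polynomial.expand_eq_comp_X_pow, Polynomial.comp_assoc]
    · simp [polynomialRoot_root]
  exact RingHom.congr_fun this x

lemma value_neg_one (z : D.Chain ℚ[X] Polynomial.X) :
    polynomialRoot.value (-1) z = (polynomialRoot.value 1 z).comp (-Polynomial.X) := by
  rw [RootExtension.value, RootExtension.value, one_smul, RootExtension.edgeEval,
    RootExtension.edgeEval, ← polynomialRoot_eval_neg]
  congr 2
  funext s
  simp

lemma value_eq_zero_of_value_one {z : D.Chain ℚ[X] Polynomial.X}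
    (h : polynomialRoot.value 1 z = 0) (u : ℤˣ) : polynomialRoot.value u z = 0 := by
  rcases Int.units_eq_one_or u with rfl | rfl
  · exact h
  · rw [value_neg_one, h, Polynomial.zero_comp]

end GaussCode

/-! ### Cohomology modulo torsion -/

namespace GaussCode

variable {D : GaussCode}

/-- The value at the alternating colouring as a semilinear map on cycles. -/
def cyclesValue (D : GaussCode) (i : ℤ) :
    D.cycles ℚ[X] Polynomial.X i →ₛₗ[polynomialRoot.toHom] ℚ[X] where
  toFun z := polynomialRoot.value 1 (z : D.Chain ℚ[X] Polynomial.X)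
  map_add' _ _ := RootExtension.value_add _ _ _ _
  map_smul' _ _ := RootExtension.value_smul _ _ _ _

/-- The value at the alternating colouring as a map on cohomology. -/
def cohomologyValue (hD : D.IsEven) (i : ℤ) :
    D.Cohomology ℚ[X] Polynomial.X i →ₛₗ[polynomialRoot.toHom] ℚ[X] :=
  Submodule.liftQ _ (cyclesValue D i) (by
    rintro z ⟨y, hy⟩
    have h := polynomialRoot.value_differential hD 1 y
    rw [hy] at h
    exact h)

/-- The value at the alternating colouring as a map on cohomology modulo torsion. -/
def modTorsionValue (hD : D.IsEven) (i : ℤ) :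
    D.CohomologyModTorsion ℚ[X] Polynomial.X i →ₛₗ[polynomialRoot.toHom] ℚ[X] :=
  Submodule.liftQ _ (cohomologyValue hD i) (by
    intro x hx
    obtain ⟨a, ha⟩ := (Submodule.mem_torsion_iff x).1 hx
    have h : cohomologyValue hD i ((a : ℚ[X]) • x) = 0 :=
      (congrArg _ ha).trans (map_zero _)
    rw [map_smulₛₗ, smul_eq_mul, mul_eq_zero] at h
    refine h.resolve_left fun h0 => nonZeroDivisors.coe_ne_zero a ?_
    exact polynomialRoot.injective (h0.trans (map_zero _).symm))

lemma hPrimeClass_surjective (i : ℤ) : Function.Surjective (D.hPrimeClass i) := by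
  intro ξ
  obtain ⟨x, hx⟩ := Submodule.Quotient.mk_surjective _ ((Module.AEval'.of _).symm ξ)
  obtain ⟨z, rfl⟩ := Submodule.Quotient.mk_surjective _ x
  exact ⟨z, by rw [hPrimeClass, hx, LinearEquiv.apply_symm_apply]⟩

/-- The value at the alternating colouring as a `ℚ[X]`-linear map on `H'`. -/
def hPrimeValue (hD : D.IsEven) (i : ℤ) : D.HPrime i →ₗ[ℚ[X]] ℚ[X] :=
  LinearMap.ofAEval _
    { toFun := modTorsionValue hD i
      map_add' := map_add _
      map_smul' := fun q x => by
        rw [← algebraMap_smul ℚ[X] q x, map_smulₛₗ, polynomialRoot_toHom,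
          Polynomial.algebraMap_eq, Polynomial.expand_C, RingHom.id_apply,
          Polynomial.smul_eq_C_mul, smul_eq_mul] }
    (by
      intro x
      obtain ⟨x, rfl⟩ := Submodule.Quotient.mk_surjective _ x
      obtain ⟨z, rfl⟩ := Submodule.Quotient.mk_surjective _ x
      refine (polynomialRoot.value_xChain hD 1 (z : D.Chain ℚ[X] Polynomial.X)).trans ?_
      simp only [polynomialRoot_root, Units.val_one, Int.cast_one, one_mul]
      rfl)

lemma hPrimeValue_hPrimeClass (hD : D.IsEven) (i : ℤ) (z : D.cycles ℚ[X] Polynomial.X i) :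
    hPrimeValue hD i (D.hPrimeClass i z) =
      polynomialRoot.value 1 (z : D.Chain ℚ[X] Polynomial.X) := rfl

/-- Cycles without values at the alternating colouring represent torsion classes. -/
lemma hPrimeClass_eq_zero (hD : D.IsEven) {i : ℤ} {z : D.cycles ℚ[X] Polynomial.X i}
    (hz : polynomialRoot.value 1 (z : D.Chain ℚ[X] Polynomial.X) = 0) :
    D.hPrimeClass i z = 0 := by
  rw [hPrimeClass, LinearEquiv.map_eq_zero_iff, Submodule.Quotient.mk_eq_zero,
    Submodule.mem_torsion_iff]
  have hne : (2 : ℚ[X]) ^ (2 * D.n + 1) * Polynomial.X ^ (2 * D.n + 1) ≠ 0 :=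
    mul_ne_zero (pow_ne_zero _ two_ne_zero) (pow_ne_zero _ Polynomial.X_ne_zero)
  refine ⟨⟨_, mem_nonZeroDivisors_of_ne_zero hne⟩, ?_⟩
  obtain ⟨y, hy⟩ := polynomialRoot.smul_mem_range_of_value_eq_zero hD z.2.1
    (value_eq_zero_of_value_one hz)
  change Submodule.Quotient.mk (((2 : ℚ[X]) ^ (2 * D.n + 1) * Polynomial.X ^ (2 * D.n + 1)) • z) = _
  rw [Submodule.Quotient.mk_eq_zero]
  exact ⟨y, hy⟩

lemma hPrimeValue_injective (hD : D.IsEven) (i : ℤ) : Function.Injective (hPrimeValue hD i) := by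
  rw [injective_iff_map_eq_zero]
  intro ξ hξ
  obtain ⟨z, rfl⟩ := hPrimeClass_surjective i ξ
  exact hPrimeClass_eq_zero hD hξ

/-- The oriented resolution is in cohomological degree zero, so that cycles of other degrees have no
values there. -/
lemma subsingleton_hPrime (hD : D.IsEven) {i : ℤ} (hi : i ≠ 0) : Subsingleton (D.HPrime i) := by
  refine subsingleton_of_forall_eq 0 fun ξ => ?_
  obtain ⟨z, rfl⟩ := hPrimeClass_surjective i ξ
  apply hPrimeClass_eq_zero hD
  rw [RootExtension.value, z.2.2, map_zero]
  rw [weight_orientedVertex, sub_self]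
  exact hi.symm

lemma xChain_pow_mem {i j : ℤ} {z : D.Chain ℚ[X] Polynomial.X}
    (hz : z ∈ D.cycles ℚ[X] Polynomial.X i) (hzj : z ∈ D.chainsOfDegree j) (k : ℕ) :
    (D.xChain ℚ[X] Polynomial.X ^ k) z ∈ D.cycles ℚ[X] Polynomial.X i ∧
      (D.xChain ℚ[X] Polynomial.X ^ k) z ∈ D.chainsOfDegree (j + 2 * k) := by
  induction k with
  | zero => simpa using ⟨hz, hzj⟩
  | succ k ih =>
    rw [pow_succ', Module.End.mul_apply]
    refine ⟨D.xChain_mem_cycles _ _ i _ ih.1, ?_⟩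
    have := xChain_mem_chainsOfDegree ih.2
    push_cast
    rwa [mul_add, mul_one, ← add_assoc]

lemma value_xChain_pow (hD : D.IsEven) (z : D.Chain ℚ[X] Polynomial.X) (k : ℕ) :
    polynomialRoot.value 1 ((D.xChain ℚ[X] Polynomial.X ^ k) z) =
      Polynomial.X ^ k * polynomialRoot.value 1 z := by
  induction k with
  | zero => simp
  | succ k ih =>
    rw [pow_succ', Module.End.mul_apply, RootExtension.value_xChain _ hD, ih, polynomialRoot_root]
    simp only [Units.val_one, Int.cast_one, one_mul]
    ring

/-- If `X ^ m` generates the ideal of values, then division of the values by `X ^ m` identifies `H'`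
with `ℚ[X]`, the degrees being shifted accordingly. -/
lemma exists_equiv_hPrime (hD : D.IsEven) {m : ℕ}
    (hm : ∀ z : D.Chain ℚ[X] Polynomial.X, D.differential ℚ[X] Polynomial.X z = 0 →
      Polynomial.X ^ m ∣ polynomialRoot.value 1 z)
    {z₀ : D.Chain ℚ[X] Polynomial.X} (hz₀ : z₀ ∈ D.cycles ℚ[X] Polynomial.X 0)
    (hdeg : z₀ ∈ D.chainsOfDegree (2 * m - degreeShift D.orientedVertex))
    (hval : polynomialRoot.value 1 z₀ = Polynomial.X ^ m) :
    ∃ e : ℚ[X] ≃ₗ[ℚ[X]] D.HPrime 0, ∀ j : ℤ,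
      e '' shiftedPolynomialsOfDegree (2 * m - degreeShift D.orientedVertex) j =
        D.hPrimeOfDegree 0 j := by
  have hXm : (Polynomial.X ^ m : ℚ[X]) ≠ 0 := pow_ne_zero _ Polynomial.X_ne_zero
  let e₀ : ℚ[X] →ₗ[ℚ[X]] D.HPrime 0 :=
    LinearMap.toSpanSingleton ℚ[X] (D.HPrime 0) (D.hPrimeClass 0 ⟨z₀, hz₀⟩)
  have he₀ : ∀ p, hPrimeValue hD 0 (e₀ p) = p * Polynomial.X ^ m := by
    intro p
    rw [LinearMap.toSpanSingleton_apply, map_smul, hPrimeValue_hPrimeClass, smul_eq_mul, hval]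
  have hbij : Function.Bijective e₀ := by
    constructor
    · intro p q hpq
      have := congrArg (hPrimeValue hD 0) hpq
      rw [he₀, he₀] at this
      exact mul_right_cancel₀ hXm this
    · intro ξ
      obtain ⟨z, rfl⟩ := hPrimeClass_surjective 0 ξ
      obtain ⟨p, hp⟩ := hm z z.2.1
      refine ⟨p, hPrimeValue_injective hD 0 ?_⟩
      rw [he₀, hPrimeValue_hPrimeClass, hp, mul_comm]
  refine ⟨LinearEquiv.ofBijective e₀ hbij, fun j => ?_⟩
  ext ξ
  constructor
  · rintro ⟨p, hp, rfl⟩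
    rw [LinearEquiv.ofBijective_apply]
    obtain ⟨i, hi⟩ := exists_eq_C_mul_X_pow (k := j - (2 * m - degreeShift D.orientedVertex))
      (p := p) fun i hi => by rw [← hp i hi]; ring
    by_cases hc : p.coeff i = 0
    · rw [hi, hc, map_zero, zero_mul, map_zero]
      exact ⟨0, Submodule.zero_mem _, hPrimeClass_eq_zero hD
        (map_zero (polynomialRoot.edgeEval _ _))⟩
    have hj := hp i hc
    obtain ⟨h1, h2⟩ := xChain_pow_mem hz₀ hdeg i
    refine ⟨p.coeff i • ⟨_, h1⟩, ?_, hPrimeValue_injective hD 0 ?_⟩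
    · rw [← hj, add_comm]
      exact Submodule.smul_mem _ _ h2
    · rw [he₀, hPrimeValue_hPrimeClass]
      refine (value_rat_smul 1 (p.coeff i) _).trans ?_
      rw [value_xChain_pow hD, hval, Polynomial.smul_eq_C_mul, ← mul_assoc, ← hi]
  · rintro ⟨z, hz, rfl⟩
    obtain ⟨p, hp⟩ := hbij.2 (D.hPrimeClass 0 z)
    refine ⟨p, fun i hi => ?_, hp⟩
    have h1 := congrArg (hPrimeValue hD 0) hp
    rw [he₀, hPrimeValue_hPrimeClass] at h1
    have h2 : (polynomialRoot.value 1 (z : D.Chain ℚ[X] Polynomial.X)).coeff (i + m) ≠ 0 := by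
      rwa [← h1, Polynomial.coeff_mul_X_pow]
    have h3 := coeff_edgeEval hz h2
    push_cast at h3
    omega

end GaussCode

/-! ### Specialization to Lee's complex -/

namespace GaussCode

section Specialize

variable {S : Type}

/-- The specialization `t = 1` of a tensor power. -/
def specialize (S : Type) : TensorPower ℚ[X] Polynomial.X S →+* TensorPower ℚ 1 S :=
  Ideal.Quotient.lift (relIdeal ℚ[X] Polynomial.X S)
    (MvPolynomial.eval₂Hom ((algebraMap ℚ (TensorPower ℚ 1 S)).comp (Polynomial.evalRingHom 1))
      (gen ℚ 1)) (by
    intro a ha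
    rw [← RingHom.mem_ker]
    refine (Ideal.span_le.2 ?_ : relIdeal ℚ[X] Polynomial.X S ≤ RingHom.ker _) ha
    rintro _ ⟨s, rfl⟩
    simp [RingHom.mem_ker, gen_sq])

@[simp] lemma specialize_gen (s : S) : specialize S (gen ℚ[X] Polynomial.X s) = gen ℚ 1 s := by
  change MvPolynomial.eval₂Hom _ _ (MvPolynomial.X s) = _
  simp

@[simp] lemma specialize_smul (p : ℚ[X]) (a : TensorPower ℚ[X] Polynomial.X S) :
    specialize S (p • a) = p.eval 1 • specialize S a := by
  rw [Algebra.smul_def, map_mul, Algebra.smul_def]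
  congr 1
  change MvPolynomial.eval₂Hom _ _ (MvPolynomial.C p) = _
  simp

lemma specialize_rat_smul (q : ℚ) (a : TensorPower ℚ[X] Polynomial.X S) :
    specialize S (q • a) = q • specialize S a := by
  rw [← algebraMap_smul ℚ[X] q a, specialize_smul, Polynomial.algebraMap_eq, Polynomial.eval_C]

lemma specialize_monomial (T : Finset S) :
    specialize S (monomial ℚ[X] Polynomial.X T) = monomial ℚ 1 T := by
  simp [monomial]

lemma specialize_tensorMap {S' : Type} (f : S → S') (a : TensorPower ℚ[X] Polynomial.X S) :
    specialize S' (tensorMap ℚ[X] Polynomial.X f a) = tensorMap ℚ 1 f (specialize S a) := by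
  have : (specialize S').comp (tensorMap ℚ[X] Polynomial.X f : _ →+* _) =
      (tensorMap ℚ 1 f : TensorPower ℚ 1 S →+* TensorPower ℚ 1 S').comp (specialize S) := by
    refine tensorPower_hom_ext (fun r => ?_) fun s => ?_
    · simp
    · simp [tensorMap_gen]
  exact RingHom.congr_fun this a

/-- The square root `1` of `t = 1`. -/
def leeRoot : RootExtension ℚ 1 ℚ where
  toHom := RingHom.id ℚ
  injective := Function.injective_id
  root := 1
  root_sq := by simp
  root_ne_zero := one_ne_zero

lemma leeRoot_eval_specialize (ε : S → ℤˣ) (a : TensorPower ℚ[X] Polynomial.X S) :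
    leeRoot.eval ε (specialize S a) = (polynomialRoot.eval ε a).eval 1 := by
  have : (leeRoot.eval ε).comp (specialize S) =
      (Polynomial.evalRingHom 1).comp (polynomialRoot.eval ε) := by
    refine tensorPower_hom_ext (fun r => ?_) fun s => ?_
    · simp [polynomialRoot_toHom, leeRoot, Polynomial.expand_eval]
    · simp [polynomialRoot_root, leeRoot]
  exact RingHom.congr_fun this a

end Specialize

variable {D : GaussCode}

/-- The specialization `t = 1` of a chain. -/
def specializeChain (z : D.Chain ℚ[X] Polynomial.X) : D.Chain ℚ 1 := fun v => specialize _ (z v)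

lemma specialize_edgeMap (v w : D.Vertex) (c : Fin D.n) (a : D.VertexModule ℚ[X] Polynomial.X v) :
    specialize _ (D.edgeMap ℚ[X] Polynomial.X v w c a) =
      D.edgeMap ℚ 1 v w c (specialize _ a) := by
  simp only [edgeMap, LinearMap.comp_apply, AlgHom.toLinearMap_apply, LinearMap.mulRight_apply,
    map_mul, specialize_tensorMap, edgeFactor]
  split_ifs <;> simp

lemma differential_specializeChain (z : D.Chain ℚ[X] Polynomial.X) :
    D.differential ℚ 1 (specializeChain z) =
      specializeChain (D.differential ℚ[X] Polynomial.X z) := by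
  funext w
  simp only [specializeChain, differential_apply, map_sum, map_zsmul, specialize_edgeMap]

lemma leeRoot_value_specializeChain (u : ℤˣ) (z : D.Chain ℚ[X] Polynomial.X) :
    leeRoot.value u (specializeChain z) = (polynomialRoot.value u z).eval 1 :=
  leeRoot_eval_specialize _ _

lemma mem_leeFiltration {k : ℤ} {z : D.Chain ℚ 1} : z ∈ D.leeFiltration k ↔
    ∀ v, z v ∈ Submodule.span ℚ {x | ∃ T : Finset (D.Circle v),
      k + 2 * T.card ≤ degreeShift v ∧ x = monomial ℚ 1 T} := by
  rw [leeFiltration, Submodule.mem_pi]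
  simp only [Set.mem_univ, true_imp_iff]
  refine forall_congr' fun v => ?_
  refine iff_of_eq (congrArg (fun U => z v ∈ Submodule.span ℚ U) (Set.ext fun x => ?_))
  refine exists_congr fun T => and_congr_left' ?_
  unfold degreeShift
  omega

lemma leeFiltration_antitone : Antitone D.leeFiltration := by
  intro k k' hk z hz
  rw [mem_leeFiltration] at hz ⊢
  refine fun v => Submodule.span_mono ?_ (hz v)
  rintro _ ⟨T, hT, rfl⟩
  exact ⟨T, by omega, rfl⟩

lemma specializeChain_mem_leeFiltration {j : ℤ} {z : D.Chain ℚ[X] Polynomial.X}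
    (hz : z ∈ D.chainsOfDegree j) : specializeChain z ∈ D.leeFiltration (-j) := by
  rw [mem_chainsOfDegree] at hz
  rw [mem_leeFiltration]
  intro v
  have := hz v
  rw [specializeChain]
  generalize z v = x at this
  induction this using Submodule.span_induction with
  | mem _ h =>
    obtain ⟨a, T, hk, rfl⟩ := h
    rw [specialize_smul, specialize_monomial, Polynomial.eval_pow, Polynomial.eval_X, one_pow,
      one_smul]
    exact Submodule.subset_span ⟨T, by omega, rfl⟩
  | zero => rw [map_zero]; exact Submodule.zero_mem _
  | add x y _ _ hx hy => rw [map_add]; exact Submodule.add_mem _ hx hy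
  | smul q x _ hx => rw [specialize_rat_smul]; exact Submodule.smul_mem _ _ hx

/-- A chain in an even step of the filtration of Lee's complex is a sum of two specializations of
homogeneous chains, one for each odd residue modulo `4` of the degrees of its components. -/
lemma exists_specializeChain_add (hD : D.IsEven) {k : ℤ} (hk : Even k) {z : D.Chain ℚ 1}
    (hz : z ∈ D.leeFiltration k) : ∃ z₁ ∈ D.chainsOfDegree (-k - 1),
      ∃ z₂ ∈ D.chainsOfDegree (-k - 3), z = specializeChain z₁ + specializeChain z₂ := by
  have hv : ∀ v, ∃ x₁ ∈ homogeneous (D.Circle v) (-k - 1 + degreeShift v),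
      ∃ x₂ ∈ homogeneous (D.Circle v) (-k - 3 + degreeShift v),
        z v = specialize _ x₁ + specialize _ x₂ := by
    intro v
    have := mem_leeFiltration.1 hz v
    generalize z v = x at this
    induction this using Submodule.span_induction with
    | mem _ h =>
      obtain ⟨T, hT, rfl⟩ := h
      have hodd := odd_numCircles_add_weight hD v
      have hsp : ∀ a : ℕ, specialize _ ((Polynomial.X ^ a : ℚ[X]) •
          monomial ℚ[X] Polynomial.X T) = monomial ℚ 1 T := fun a => by
        rw [specialize_smul, specialize_monomial, Polynomial.eval_pow, Polynomial.eval_X, one_pow,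
          one_smul]
      obtain ⟨r, hr⟩ := hk
      obtain ⟨r', hr'⟩ := hodd
      obtain ⟨b, hb⟩ : ∃ b : ℕ, degreeShift v - 2 * T.card - k - 1 = 2 * b := by
        refine ⟨((degreeShift v - 2 * T.card - k - 1) / 2).toNat, ?_⟩
        unfold degreeShift at hT ⊢
        omega
      rcases Nat.even_or_odd' b with ⟨a, rfl | rfl⟩
      · exact ⟨_, Submodule.subset_span ⟨a, T, by push_cast at hb; omega, rfl⟩, 0,
          Submodule.zero_mem _, by rw [map_zero, add_zero, hsp]⟩
      · exact ⟨0, Submodule.zero_mem _, _,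
          Submodule.subset_span ⟨a, T, by push_cast at hb; omega, rfl⟩,
          by rw [map_zero, zero_add, hsp]⟩
    | zero => exact ⟨0, Submodule.zero_mem _, 0, Submodule.zero_mem _, by simp⟩
    | add x y _ _ hx hy =>
      obtain ⟨x₁, hx₁, x₂, hx₂, rfl⟩ := hx
      obtain ⟨y₁, hy₁, y₂, hy₂, rfl⟩ := hy
      exact ⟨_, Submodule.add_mem _ hx₁ hy₁, _, Submodule.add_mem _ hx₂ hy₂, by
        rw [map_add, map_add]; abel⟩
    | smul q x _ hx =>
      obtain ⟨x₁, hx₁, x₂, hx₂, rfl⟩ := hx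
      exact ⟨_, Submodule.smul_mem _ q hx₁, _, Submodule.smul_mem _ q hx₂, by
        rw [specialize_rat_smul, specialize_rat_smul, smul_add]⟩
  choose x₁ h₁ x₂ h₂ h using hv
  exact ⟨x₁, mem_chainsOfDegree.2 h₁, x₂, mem_chainsOfDegree.2 h₂, funext h⟩

/-- Multiples of consecutive powers of `X` are determined by the values of their sum at `1`
and `-1`. -/
lemma eq_zero_of_eval_one_of_eval_neg_one {p q : ℚ[X]} {k : ℤ}
    (hp : ∀ i : ℕ, p.coeff i ≠ 0 → 2 * (i : ℤ) = k)
    (hq : ∀ i : ℕ, q.coeff i ≠ 0 → 2 * (i : ℤ) = k - 2)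
    (h₁ : p.eval 1 + q.eval 1 = 0) (h₂ : p.eval (-1) + q.eval (-1) = 0) : p = 0 ∧ q = 0 := by
  obtain ⟨i, hi⟩ := exists_eq_C_mul_X_pow hp
  obtain ⟨j, hj⟩ := exists_eq_C_mul_X_pow hq
  set a := p.coeff i with ha
  set b := q.coeff j with hb
  have h : a = 0 ∧ b = 0 := by
    rw [hi, hj] at h₁ h₂
    simp only [Polynomial.eval_mul, Polynomial.eval_C, Polynomial.eval_pow, Polynomial.eval_X,
      one_pow, mul_one] at h₁ h₂
    by_cases ha0 : a = 0
    · exact ⟨ha0, by linarith⟩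
    by_cases hb0 : b = 0
    · exact ⟨by linarith, hb0⟩
    have h3 := hp i ha0
    have h4 := hq j hb0
    obtain rfl : i = j + 1 := by omega
    rcases neg_one_pow_eq_or ℚ j with h5 | h5 <;> rw [pow_succ, h5] at h₂ <;>
      constructor <;> linarith
  rw [hi, hj, h.1, h.2]
  simp

lemma polynomialRoot_edgeEval_neg (v : D.Vertex) (ε : D.Edge → ℤˣ)
    (x : D.VertexModule ℚ[X] Polynomial.X v) : polynomialRoot.edgeEval v (-ε) x =
      (polynomialRoot.edgeEval v ε x).comp (-Polynomial.X) :=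
  polynomialRoot_eval_neg _ _

lemma eq_zero_of_specializeChain_add {j : ℤ} {z₁ z₂ : D.Chain ℚ[X] Polynomial.X}
    (h₁ : z₁ ∈ D.chainsOfDegree j) (h₂ : z₂ ∈ D.chainsOfDegree (j - 2))
    (h : specializeChain z₁ + specializeChain z₂ = 0) : z₁ = 0 ∧ z₂ = 0 := by
  have key : ∀ (v : D.Vertex) (ε : D.Edge → ℤˣ),
      polynomialRoot.edgeEval v ε (z₁ v) = 0 ∧ polynomialRoot.edgeEval v ε (z₂ v) = 0 := by
    intro v ε
    have he : ∀ ε : D.Edge → ℤˣ, (polynomialRoot.edgeEval v ε (z₁ v)).eval 1 +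
        (polynomialRoot.edgeEval v ε (z₂ v)).eval 1 = 0 := by
      intro ε
      have := congrArg (fun z : D.Chain ℚ 1 => leeRoot.edgeEval v ε (z v)) h
      simp only [Pi.add_apply, map_add, Pi.zero_apply, map_zero] at this
      rw [← this]
      exact congrArg₂ _ (leeRoot_eval_specialize _ _).symm (leeRoot_eval_specialize _ _).symm
    refine eq_zero_of_eval_one_of_eval_neg_one (k := j + degreeShift v)
      (fun i => coeff_edgeEval h₁) (fun i hi => ?_) (he ε) ?_
    · rw [coeff_edgeEval h₂ hi]; ring
    · have := he (-ε)
      rw [polynomialRoot_edgeEval_neg, polynomialRoot_edgeEval_neg] at this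
      simpa using this
  constructor <;> funext v <;> refine polynomialRoot.edgeEval_ext fun ε _ => ?_
  · rw [(key v ε).1]; simp
  · rw [(key v ε).2]; simp

/-! ### The filtration of Lee's homology -/

/-- The class of a cycle in Lee's homology. -/
def leeClass (z : LinearMap.ker (D.differential ℚ 1)) : D.LeeHomology := Submodule.Quotient.mk z

lemma leeClass_surjective : Function.Surjective (leeClass : _ → D.LeeHomology) :=
  Submodule.Quotient.mk_surjective _

lemma leeRoot_value_sub (u : ℤˣ) (z z' : D.Chain ℚ 1) :
    leeRoot.value u (z - z') = leeRoot.value u z - leeRoot.value u z' :=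
  map_sub _ _ _

/-- Lee's homology is detected by the two values at the oriented resolution. -/
lemma leeClass_eq_iff (hD : D.IsEven) {z z' : LinearMap.ker (D.differential ℚ 1)} :
    leeClass z = leeClass z' ↔
      ∀ u, leeRoot.value u (z : D.Chain ℚ 1) = leeRoot.value u (z' : D.Chain ℚ 1) := by
  rw [leeClass, leeClass, Submodule.Quotient.eq]
  constructor
  · rintro ⟨y, hy⟩ u
    have h := leeRoot.value_differential hD u y
    rw [hy] at h
    exact sub_eq_zero.1 ((leeRoot_value_sub u _ _).symm.trans h)
  · intro h
    have h1 := leeRoot.smul_mem_range_of_value_eq_zero hD (z - z').2 fun u => by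
      rw [Submodule.coe_sub, leeRoot_value_sub, h, sub_self]
    have hne : (2 : ℚ) ^ (2 * D.n + 1) * 1 ^ (2 * D.n + 1) ≠ 0 := by positivity
    exact (Submodule.smul_mem_iff _ hne).1 h1

lemma leeClass_mem {k : ℤ} {z : LinearMap.ker (D.differential ℚ 1)}
    (hz : (z : D.Chain ℚ 1) ∈ D.leeFiltration k) : leeClass z ∈ D.leeHomologyFiltration k :=
  ⟨z, hz, rfl⟩

lemma exists_leeClass {k : ℤ} {ξ : D.LeeHomology} (hξ : ξ ∈ D.leeHomologyFiltration k) :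
    ∃ z : LinearMap.ker (D.differential ℚ 1),
      (z : D.Chain ℚ 1) ∈ D.leeFiltration k ∧ leeClass z = ξ := by
  obtain ⟨z, hz, rfl⟩ := hξ
  exact ⟨z, hz, rfl⟩

lemma leeHomologyFiltration_antitone : Antitone D.leeHomologyFiltration := by
  intro k k' hk ξ hξ
  obtain ⟨z, hz, rfl⟩ := exists_leeClass hξ
  exact leeClass_mem (leeFiltration_antitone hk hz)

section Generator

variable {m : ℕ} (hm : ∀ z : D.Chain ℚ[X] Polynomial.X, D.differential ℚ[X] Polynomial.X z = 0 →
  Polynomial.X ^ m ∣ polynomialRoot.value 1 z)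
include hm

/-- In degrees below that of the generator of the ideal of values, cycles have no values. -/
lemma value_eq_zero_of_degree_lt {j : ℤ} {z : D.Chain ℚ[X] Polynomial.X}
    (hz : z ∈ D.chainsOfDegree j) (hd : D.differential ℚ[X] Polynomial.X z = 0)
    (hj : j < 2 * m - degreeShift D.orientedVertex) (u : ℤˣ) : polynomialRoot.value u z = 0 := by
  refine value_eq_zero_of_value_one ?_ u
  ext i
  rw [Polynomial.coeff_zero]
  by_contra hi
  have hi' : (polynomialRoot.value 1 z).coeff i ≠ 0 := hi
  have h1 := coeff_edgeEval hz hi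
  exact hi' (Polynomial.X_pow_dvd_iff.1 (hm z hd) i (by omega))

/-- The values of a Lee cycle in an even step of the filtration, from the one below the degree of
the generator on, are those of the specialization of a single homogeneous cycle: the other
component has too small a `q`-degree. -/
lemma exists_value_eq (hD : D.IsEven) {k : ℤ} (hk : Even k)
    (hkm : degreeShift D.orientedVertex - 2 * m - 1 ≤ k) {z : D.Chain ℚ 1}
    (hz : z ∈ D.leeFiltration k) (hd : D.differential ℚ 1 z = 0) :
    ∃ z₁ ∈ D.chainsOfDegree (-k - 1), D.differential ℚ[X] Polynomial.X z₁ = 0 ∧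
      ∀ u, leeRoot.value u z = (polynomialRoot.value u z₁).eval 1 := by
  obtain ⟨z₁, h₁, z₂, h₂, rfl⟩ := exists_specializeChain_add hD hk hz
  rw [map_add, differential_specializeChain, differential_specializeChain] at hd
  obtain ⟨hd₁, hd₂⟩ := eq_zero_of_specializeChain_add (differential_mem_chainsOfDegree hD h₁)
    (by
      have := differential_mem_chainsOfDegree hD h₂
      rwa [show -k - 3 = -k - 1 - 2 by ring] at this) hd
  refine ⟨z₁, h₁, hd₁, fun u => ?_⟩
  rw [RootExtension.value_add, leeRoot_value_specializeChain, leeRoot_value_specializeChain,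
    value_eq_zero_of_degree_lt hm h₂ hd₂ (by omega), Polynomial.eval_zero, add_zero]

lemma eq_zero_of_mem_leeHomologyFiltration (hD : D.IsEven) {s k : ℤ} (hs : Even s)
    (hsm : s = degreeShift D.orientedVertex - 2 * m - 1) (hk : s + 2 ≤ k) {ξ : D.LeeHomology}
    (hξ : ξ ∈ D.leeHomologyFiltration k) : ξ = 0 := by
  obtain ⟨z, hz, rfl⟩ := exists_leeClass (leeHomologyFiltration_antitone hk hξ)
  obtain ⟨z₁, h₁, hd₁, hv⟩ := exists_value_eq hm hD (k := s + 2) (hs.add even_two) (by omega) hz z.2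
  refine ((leeClass_eq_iff hD (z' := 0)).2 fun u => ?_).trans (Submodule.Quotient.mk_zero _)
  rw [hv, value_eq_zero_of_degree_lt hm h₁ hd₁ (by omega)]
  exact Polynomial.eval_zero.trans (map_zero (leeRoot.edgeEval _ _)).symm

lemma value_neg_one_of_mem_leeHomologyFiltration (hD : D.IsEven) {s : ℤ} (hs : Even s)
    (hsm : s = degreeShift D.orientedVertex - 2 * m - 1)
    {z : LinearMap.ker (D.differential ℚ 1)} (hz : leeClass z ∈ D.leeHomologyFiltration s) :
    leeRoot.value (-1) (z : D.Chain ℚ 1) = (-1) ^ m * leeRoot.value 1 (z : D.Chain ℚ 1) := by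
  obtain ⟨z', hz', h⟩ := exists_leeClass hz
  rw [leeClass_eq_iff hD] at h
  obtain ⟨z₁, h₁, hd₁, hv⟩ := exists_value_eq hm hD hs (by omega) hz' z'.2
  rw [← h, ← h, hv, hv, value_neg_one]
  have hp : polynomialRoot.value 1 z₁ =
      Polynomial.C ((polynomialRoot.value 1 z₁).coeff m) * Polynomial.X ^ m := by
    ext i
    rw [Polynomial.coeff_C_mul_X_pow]
    split_ifs with hi
    · rw [hi]
    · by_contra hi'
      have := coeff_edgeEval h₁ hi'
      omega
  generalize (polynomialRoot.value 1 z₁).coeff m = c at hp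
  rw [hp]
  simp only [Polynomial.mul_comp, Polynomial.C_comp, Polynomial.X_pow_comp, Polynomial.eval_mul,
    Polynomial.eval_C, Polynomial.eval_pow, Polynomial.eval_neg, Polynomial.eval_X, one_pow]
  ring

/-- The specialization of the generator of the ideal of values has filtration degree `s + 1`, and
its multiple by `X` has filtration degree `s - 1`. -/
theorem isRasmussenInvariant (hD : D.IsEven) {s : ℤ} (hs : Even s)
    (hsm : s = degreeShift D.orientedVertex - 2 * m - 1) {z₀ : D.Chain ℚ[X] Polynomial.X}
    (hz₀ : D.differential ℚ[X] Polynomial.X z₀ = 0)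
    (hdeg : z₀ ∈ D.chainsOfDegree (2 * m - degreeShift D.orientedVertex))
    (hval : polynomialRoot.value 1 z₀ = Polynomial.X ^ m) : D.IsRasmussenInvariant s := by
  let a : LinearMap.ker (D.differential ℚ 1) := ⟨specializeChain z₀, by
    rw [LinearMap.mem_ker, differential_specializeChain, hz₀]
    exact funext fun v => map_zero _⟩
  let b : LinearMap.ker (D.differential ℚ 1) :=
    ⟨specializeChain (D.xChain ℚ[X] Polynomial.X z₀), by
      rw [LinearMap.mem_ker, differential_specializeChain, differential_xChain, hz₀, map_zero]
      exact funext fun v => map_zero _⟩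
  have haF : (a : D.Chain ℚ 1) ∈ D.leeFiltration (s + 1) := by
    have := specializeChain_mem_leeFiltration hdeg
    rwa [show s + 1 = -(2 * m - degreeShift D.orientedVertex) by omega]
  have hbF : (b : D.Chain ℚ 1) ∈ D.leeFiltration (s - 1) := by
    have := specializeChain_mem_leeFiltration (xChain_mem_chainsOfDegree hdeg)
    rwa [show s - 1 = -(2 * m - degreeShift D.orientedVertex + 2) by omega]
  have ha₁ : leeRoot.value 1 (a : D.Chain ℚ 1) = 1 := by
    rw [leeRoot_value_specializeChain, hval]; simp
  have ha₂ : leeRoot.value (-1) (a : D.Chain ℚ 1) = (-1) ^ m := by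
    rw [leeRoot_value_specializeChain, value_neg_one, hval]; simp
  have hb₁ : leeRoot.value 1 (b : D.Chain ℚ 1) = 1 := by
    rw [leeRoot_value_specializeChain, RootExtension.value_xChain _ hD, hval]
    simp [polynomialRoot_root]
  have hb₂ : leeRoot.value (-1) (b : D.Chain ℚ 1) = -(-1) ^ m := by
    rw [leeRoot_value_specializeChain, RootExtension.value_xChain _ hD, value_neg_one, hval]
    simp [polynomialRoot_root]
  have sq : ((-1 : ℚ) ^ m) * (-1) ^ m = 1 := by rw [← mul_pow]; simp
  have htop : ∀ ξ : D.LeeHomology, ξ ∈ D.leeHomologyFiltration (s - 1) := by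
    intro ξ
    obtain ⟨z, rfl⟩ := leeClass_surjective ξ
    set p := leeRoot.value 1 (z : D.Chain ℚ 1) with hp
    set q := (-1) ^ m * leeRoot.value (-1) (z : D.Chain ℚ 1) with hq
    have : leeClass z = leeClass (((p + q) / 2) • a + ((p - q) / 2) • b) := by
      rw [leeClass_eq_iff hD]
      intro u
      rw [Submodule.coe_add, Submodule.coe_smul, Submodule.coe_smul, RootExtension.value_add,
        RootExtension.value_smul, RootExtension.value_smul]
      change _ = (p + q) / 2 * _ + (p - q) / 2 * _
      rcases Int.units_eq_one_or u with rfl | rfl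
      · rw [ha₁, hb₁, ← hp]; ring
      · rw [ha₂, hb₂, hq]; linear_combination (-leeRoot.value (-1) (z : D.Chain ℚ 1)) * sq
    rw [this]
    refine leeClass_mem (Submodule.add_mem _ (Submodule.smul_mem _ _ ?_)
      (Submodule.smul_mem _ _ hbF))
    exact leeFiltration_antitone (by omega) haF
  have hbot : ∀ {ξ : D.LeeHomology} {k : ℤ}, ξ ≠ 0 → ξ ∈ D.leeHomologyFiltration k →
      k ≤ s + 1 := by
    intro ξ k hξ hk
    by_contra hlt
    exact hξ (eq_zero_of_mem_leeHomologyFiltration hm hD hs hsm (by omega) hk)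
  have hb : leeClass b ∉ D.leeHomologyFiltration s := by
    intro h
    have := value_neg_one_of_mem_leeHomologyFiltration hm hD hs hsm h
    rw [hb₁, hb₂, mul_one] at this
    rcases neg_one_pow_eq_or ℚ m with h' | h' <;> rw [h'] at this <;> norm_num at this
  have hb0 : leeClass b ≠ 0 := fun h => hb (h ▸ Submodule.zero_mem _)
  have ha0 : leeClass a ≠ 0 := by
    intro h
    have := (leeClass_eq_iff hD (z' := 0)).1 (h.trans (Submodule.Quotient.mk_zero _).symm) 1
    rw [ha₁] at this
    exact one_ne_zero (this.trans (map_zero (leeRoot.edgeEval _ _)))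
  refine ⟨⟨⟨leeClass b, hb0, htop _, fun k hk => ?_⟩, ?_⟩,
    ⟨leeClass a, ha0, leeClass_mem haF, fun k hk => hbot ha0 hk⟩, ?_⟩
  · by_contra hlt
    exact hb (leeHomologyFiltration_antitone (by omega) hk)
  · rintro k ⟨ξ, -, hk⟩
    exact hk.2 (htop ξ)
  · rintro k ⟨ξ, hξ, hk⟩
    exact hbot hξ hk.1

end Generator

lemma odd_degreeShift (hD : D.IsEven) (v : D.Vertex) : Odd (degreeShift v) := by
  obtain ⟨r, hr⟩ := odd_numCircles_add_weight hD v
  exact ⟨r - D.nNeg, by unfold degreeShift; omega⟩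

end GaussCode

end

theorem mainTheorem7 (D : KnotDiagram) :
    (∀ i : ℤ, i ≠ 0 → Subsingleton (D.HPrime i)) ∧
    Module.Free ℚ[X] (D.HPrime 0) ∧
    Module.rank ℚ[X] (D.HPrime 0) = 1 ∧
    ∃ s' : ℤ, Even s' ∧
      (∃ e : ℚ[X] ≃ₗ[ℚ[X]] D.HPrime 0,
        ∀ j : ℤ, e '' GaussCode.shiftedPolynomialsOfDegree (-s' - 1) j = D.hPrimeOfDegree 0 j) ∧
      D.IsRasmussenInvariant s' := by
  have hD := D.planar.isEven
  obtain ⟨m, hm, z₀, hz₀, hdeg, hval⟩ := GaussCode.exists_generator hD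
  obtain ⟨e, he⟩ := GaussCode.exists_equiv_hPrime hD hm hz₀ hdeg hval
  refine ⟨fun i hi => GaussCode.subsingleton_hPrime hD hi, Module.Free.of_equiv e, ?_,
    GaussCode.degreeShift D.orientedVertex - 2 * m - 1, ?_, ⟨e, ?_⟩, ?_⟩
  · rw [← e.rank_eq, CommSemiring.rank_self]
  · have := GaussCode.odd_degreeShift hD D.orientedVertex
    grind
  · intro j
    rw [show -(GaussCode.degreeShift D.orientedVertex - 2 * m - 1) - 1 =
      2 * m - GaussCode.degreeShift D.orientedVertex by ring]
    exact he j
  · refine GaussCode.isRasmussenInvariant hm hD ?_ rfl hz₀.1 hdeg hval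
    have := GaussCode.odd_degreeShift hD D.orientedVertex
    grind
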